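/- A dendrite is a compact, connected, locally connected, metrizable topological space in which any two distinct points are the endpoints of a unique arc. The order of a point $x$ of a dendrite $X$ is the number of connected components of $X\setminus\{x\}$ (it is at most countable; we write $\omega$ if it is infinite), and $x$ is a ramification point if its order is at least $3$. A set is arcwise dense if it meets every nondegenerate arc. For a nonempty $P\subseteq\{3,4,\ldots,\omega\}$, the Ważewski dendrite $W_P$ is the dendrite with more than one point, unique up to homeomorphism, such that every ramification point of $W_P$ has order in $P$ and, for every $p\in P$, the set of ramification points of order $p$ is arcwise dense in $W_P$. The Ellis semigroup $E(X,G)$ of an action of a topological group $G$ on a compact space $X$ by homeomorphisms is the closure of $\{x\mapsto gx : g\in G\}$ in $X^X$ with the topology of pointwise convergence. A function $f\colon Y\to Z$ is of Baire class 1 if $f^{-1}(U)$ is $F_\sigma$ in $Y$ for every open $U\subseteq Z$. A Rosenthal compactum is a space homeomorphic to a compact subspace of the space of real-valued Baire class 1 functions on some Polish space, with the topology of pointwise convergence. The action is $\mathrm{tame}_1$ if $E(X,G)$ is a first countable Rosenthal compactum. **Theorem.** Let $P\subseteq\{3,4,\ldots,\omega\}$ be nonempty. Then the Ellis semigroup $E(W_P,\mathrm{Homeo}(W_P))$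 of the natural action of $\mathrm{Homeo}(W_P)$ on $W_P$ is not first countable. In particular, this action is not $\mathrm{tame}_1$. -/

import Mathlib

open Set Topology

universe u v

/-! Dynamical systems: the Ellis semigroup and tameness. -/

/-- The Ellis (enveloping) semigroup `E(X, G)` of an action of `G` on a topological space `X`: the
closure of the set of translations `x ↦ g • x` in `X → X`, which carries the product topology (that
is, the topology of pointwise convergence). -/
def ellisSemigroup (G : Type u) (X : Type v) [Group G] [MulAction G X] [TopologicalSpace X] :
    Set (X → X) :=
  closure (range fun (g : G) (x : X) => g • x)

/-- A subset of a topological space is `F_σ` if it is a countable union of closed sets. -/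
def IsFSigmaSet {Y : Type u} [TopologicalSpace Y] (s : Set Y) : Prop :=
  ∃ F : ℕ → Set Y, (∀ n, IsClosed (F n)) ∧ s = ⋃ n, F n

/-- Functions of Baire class 1: preimages of open sets are `F_σ`. -/
def IsBaireClassOne {Y : Type u} {Z : Type v} [TopologicalSpace Y] [TopologicalSpace Z]
    (f : Y → Z) : Prop :=
  ∀ U : Set Z, IsOpen U → IsFSigmaSet (f ⁻¹' U)

/-- A Rosenthal compactum is a space homeomorphic to a compact subspace of the space of real-valued
functions of Baire class 1 on some Polish space `Y`, with the topology of pointwise convergence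
(the product topology of `Y → ℝ`). Every Polish space is homeomorphic to one in `Type`. -/
def IsRosenthalCompactum (K : Type u) [TopologicalSpace K] : Prop :=
  ∃ (Y : Type) (_ : TopologicalSpace Y) (_ : PolishSpace Y) (C : Set (Y → ℝ)),
    IsCompact C ∧ (∀ f ∈ C, IsBaireClassOne f) ∧ Nonempty (K ≃ₜ C)

/-- An action is `tame₁` if its Ellis semigroup is a first countable Rosenthal compactum. -/
def IsTameOne (G : Type u) (X : Type v) [Group G] [MulAction G X] [TopologicalSpace X] : Prop :=
  IsRosenthalCompactum (ellisSemigroup G X) ∧ FirstCountableTopology (ellisSemigroup G X)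

/-- The natural action of the homeomorphism group of `X` on `X`. -/
instance homeoMulAction (X : Type u) [TopologicalSpace X] : MulAction (X ≃ₜ X) X where
  smul g x := g x
  one_smul _ := rfl
  mul_smul _ _ _ := rfl

theorem homeo_smul_def {X : Type u} [TopologicalSpace X] (g : X ≃ₜ X) (x : X) : g • x = g x := rfl

/-! Dendrites. -/

/-- `A` is a (nondegenerate) arc with endpoints `x` and `y`. -/
def IsArcBetween {X : Type u} [TopologicalSpace X] (A : Set X) (x y : X) : Prop :=
  ∃ γ : unitInterval → X, IsEmbedding γ ∧ γ 0 = x ∧ γ 1 = y ∧ range γ = A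

/-- A dendrite: a compact, connected, locally connected, metrizable space in which any two distinct
points are the endpoints of exactly one arc. -/
structure IsDendrite (X : Type u) [TopologicalSpace X] : Prop where
  compactSpace : CompactSpace X
  connectedSpace : ConnectedSpace X
  locallyConnectedSpace : LocallyConnectedSpace X
  metrizableSpace : TopologicalSpace.MetrizableSpace X
  existsUnique_arc : ∀ x y : X, x ≠ y → ∃! A : Set X, IsArcBetween A x y

/-- The set of connected components of the complement of the point `x`. -/
def pointComponents {X : Type u} [TopologicalSpace X] (x : X) : Set (Set X) :=
  {C | ∃ y ∈ ({x}ᶜ : Set X), C = connectedComponentIn ({x}ᶜ : Set X) y}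

/-- The order of a point: the number of components of its complement, where `⊤` stands for
infinitely many (in a dendrite: countably infinitely many, i.e. order `ω`). -/
noncomputable def pointOrder {X : Type u} [TopologicalSpace X] (x : X) : ℕ∞ :=
  (pointComponents x).encard

/-- A ramification point is a point whose complement has at least three components. -/
def IsRamificationPoint {X : Type u} [TopologicalSpace X] (x : X) : Prop :=
  3 ≤ pointOrder x

/-- A set is arcwise dense if it meets every (nondegenerate) arc. -/
def IsArcwiseDense {X : Type u} [TopologicalSpace X] (S : Set X) : Prop :=
  ∀ (x y : X) (A : Set X), IsArcBetween A x y → (S ∩ A).Nonempty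

/-- `X` is (a copy of) the Ważewski dendrite `W_P`, where `P ⊆ {3, 4, …, ω}` and `ω` is `⊤ : ℕ∞`:
`X` is a nondegenerate dendrite, all its ramification points have order in `P`, and for every
`p ∈ P` the ramification points of order `p` are arcwise dense. -/
structure IsWazewskiDendrite (P : Set ℕ∞) (X : Type u) [TopologicalSpace X] : Prop where
  isDendrite : IsDendrite X
  nontrivial : Nontrivial X
  arcwiseDense : ∀ p ∈ P, IsArcwiseDense {x : X | IsRamificationPoint x ∧ pointOrder x = p}
  order_mem : ∀ x : X, IsRamificationPoint x → pointOrder x ∈ P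

/-! The witness is the constant map at an end point `x`. Homeomorphisms can squeeze any finite set
`F` into any neighbourhood of `x` while carrying a given end point `y ∉ F`, `y ≠ x`, out of a fixed
neighbourhood of `x`: the branch of `x` at a ramification point `q`. So the constant map is a limit
of translations. A countable neighbourhood base there constrains only countably many coordinates;
some end point `y` avoids them all, and no member of the base forces the value at `y` to stay in
that branch (`not_firstCountableTopology_ellisSemigroup`).

End points outside any countable set come from nested branches (`exists_isEndLike`). The
homeomorphisms come from homogeneity (`exists_homeomorph_pair`). Rooted at `x`, the ramification
points form a countable meet-tree coloured by order. Each colour is dense and equal colours have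
equally many cones, so back-and-forth carries a pair `a < b` to any pair of the same colours. The
tree order determines which ramification points share a branch, so an automorphism extends to the
dendrite by closing its graph. To contract, separate `y` from `F ∪ {x}` by `r < s`, with `s` of the
order of `q`, and send `(r, s)` to `(r', q)` with `r'` close to `x`
(`exists_homeomorph_contracting`).

All this needs points of an arc to separate its ends. If one did not, a component of its complement
would contain both ends, hence a path and then a second arc between them. This uses that compact
locally connected metric spaces are locally path connected and that every path contains an arc. -/

/-! ### Back-and-forth in coloured trees -/

section ColouredTree

variable {α : Type*} [SemilatticeInf α]

/-- The cone at `m` containing `z`: the elements which branch off from `z` strictly above `m`. -/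
def treeCone (m z : α) : Set α := {w | m < z ⊓ w}

/-- The set of all cones at `m`. -/
def treeCones (m : α) : Set (Set α) := {C | ∃ z, m < z ∧ C = treeCone m z}

/-- A coloured meet-tree which is rich enough for back-and-forth arguments. -/
structure IsRichTree {κ : Type*} (col : α → κ) : Prop where
  le_total_of_le : ∀ a b c : α, a ≤ c → b ≤ c → a ≤ b ∨ b ≤ a
  exists_lt : ∀ b c : α, ∃ z, z < b ∧ col z = col c
  exists_between : ∀ a b c : α, a < b → ∃ z, a < z ∧ z < b ∧ col z = col c
  encard_cones : ∀ a b : α, col a = col b → (treeCones a).encard = (treeCones b).encard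

/-- A finite nonempty colour-preserving partial isomorphism with meet-closed domain and range. -/
structure IsPartialTreeIso {κ : Type*} (col : α → κ) (f : Finset (α × α)) : Prop where
  nonempty : f.Nonempty
  le_iff : ∀ p ∈ f, ∀ q ∈ f, p.1 ≤ q.1 ↔ p.2 ≤ q.2
  inf_mem : ∀ p ∈ f, ∀ q ∈ f, (p.1 ⊓ q.1, p.2 ⊓ q.2) ∈ f
  col_eq : ∀ p ∈ f, col p.1 = col p.2

variable {κ : Type*} {col : α → κ}

/-- Elements below `z` form a chain, so the smaller of `z ⊓ v` and `z ⊓ w` lies below both `v` and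
`w`, and both exceed `m`. -/
theorem IsRichTree.treeCone_eq (h : IsRichTree col) {m z w : α} (hm : m < z ⊓ w) :
    treeCone m z = treeCone m w := by
  have key : ∀ z w : α, m < z ⊓ w → treeCone m z ⊆ treeCone m w := by
    intro z w hm v hv
    have hv' : m < z ⊓ v := hv
    change m < w ⊓ v
    rcases h.le_total_of_le (z ⊓ v) (z ⊓ w) z inf_le_left inf_le_left with h1 | h1
    · exact hv'.trans_le (le_inf (h1.trans inf_le_right) inf_le_right)
    · exact hm.trans_le (le_inf inf_le_right (h1.trans inf_le_right))
  exact (key z w hm).antisymm (key w z (by rwa [inf_comm]))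

theorem lt_inf_of_treeCone_eq {m z w : α} (hw : m < w) (h : treeCone m z = treeCone m w) :
    m < z ⊓ w := by
  have : w ∈ treeCone m w := by
    change m < w ⊓ w
    simpa using hw
  rw [← h] at this
  exact this

namespace IsPartialTreeIso

variable {f : Finset (α × α)}

theorem swap [DecidableEq α] (hf : IsPartialTreeIso col f) :
    IsPartialTreeIso col (f.image Prod.swap) where
  nonempty := hf.nonempty.image _
  le_iff := by
    simp only [Finset.mem_image]
    rintro _ ⟨p, hp, rfl⟩ _ ⟨q, hq, rfl⟩
    exact (hf.le_iff p hp q hq).symm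
  inf_mem := by
    simp only [Finset.mem_image]
    rintro _ ⟨p, hp, rfl⟩ _ ⟨q, hq, rfl⟩
    exact ⟨_, hf.inf_mem p hp q hq, rfl⟩
  col_eq := by
    simp only [Finset.mem_image]
    rintro _ ⟨p, hp, rfl⟩
    exact (hf.col_eq p hp).symm

theorem lt_iff (hf : IsPartialTreeIso col f) {p q : α × α} (hp : p ∈ f) (hq : q ∈ f) :
    p.1 < q.1 ↔ p.2 < q.2 := by
  rw [lt_iff_le_not_ge, lt_iff_le_not_ge, hf.le_iff p hp q hq, hf.le_iff q hq p hp]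

theorem insert_pair [DecidableEq α] (hf : IsPartialTreeIso col f) {a b : α}
    (hcol : col a = col b)
    (h1 : ∀ p ∈ f, a ≤ p.1 ↔ b ≤ p.2) (h2 : ∀ p ∈ f, p.1 ≤ a ↔ p.2 ≤ b)
    (h3 : ∀ p ∈ f, (a ⊓ p.1, b ⊓ p.2) ∈ insert (a, b) f) :
    IsPartialTreeIso col (insert (a, b) f) where
  nonempty := Finset.insert_nonempty _ _
  le_iff := by
    intro p hp q hq
    rw [Finset.mem_insert] at hp hq
    rcases hp with rfl | hp <;> rcases hq with rfl | hq
    · simp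
    · exact h1 q hq
    · exact h2 p hp
    · exact hf.le_iff p hp q hq
  inf_mem := by
    intro p hp q hq
    rw [Finset.mem_insert] at hp hq
    rcases hp with rfl | hp <;> rcases hq with rfl | hq
    · simp
    · exact h3 q hq
    · have := h3 p hp
      rwa [inf_comm a, inf_comm b] at this
    · exact Finset.mem_insert_of_mem (hf.inf_mem p hp q hq)
  col_eq := by
    intro p hp
    rw [Finset.mem_insert] at hp
    rcases hp with rfl | hp
    · exact hcol
    · exact hf.col_eq p hp

/-- Meet-closure provides a least domain element `p₀` above `a`, and every domain element below `p₀`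
is comparable with `a`. It thus suffices to place `b` in the matching gap of the chain below `p₀.2`;
no new branching occurs. -/
theorem exists_insert_of_le [DecidableEq α] (h : IsRichTree col) (hf : IsPartialTreeIso col f)
    {a : α} (ha : ∃ p ∈ f, a ≤ p.1) : ∃ b, IsPartialTreeIso col (insert (a, b) f) := by
  classical
  by_cases hdom : ∃ b, (a, b) ∈ f
  · obtain ⟨b, hb⟩ := hdom
    exact ⟨b, by rwa [Finset.insert_eq_of_mem hb]⟩
  have hne : ∀ p ∈ f, p.1 ≠ a := by
    rintro p hp rfl
    exact hdom ⟨p.2, hp⟩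
  obtain ⟨p₀, hp₀, hap₀, hmin⟩ : ∃ p₀ ∈ f, a ≤ p₀.1 ∧ ∀ q ∈ f, a ≤ q.1 → p₀.1 ≤ q.1 := by
    obtain ⟨p₀, hp₀⟩ := Finset.exists_minimalFor Prod.fst (f.filter fun p => a ≤ p.1)
      (by obtain ⟨p, hp, hap⟩ := ha; exact ⟨p, by simp [hp, hap]⟩)
    have hm : p₀ ∈ f ∧ a ≤ p₀.1 := by simpa using hp₀.prop
    refine ⟨p₀, hm.1, hm.2, fun q hq haq => ?_⟩
    have := hp₀.le_of_le (j := (p₀.1 ⊓ q.1, p₀.2 ⊓ q.2))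
      (by simp [hf.inf_mem p₀ hm.1 q hq, hm.2, haq]) inf_le_left
    exact le_trans this inf_le_right
  have hap₀' : a < p₀.1 := lt_of_le_of_ne hap₀ (hne p₀ hp₀).symm
  obtain ⟨b, hb1, hb2, hb3⟩ : ∃ b, b < p₀.2 ∧ (∀ q ∈ f, q.1 < a → q.2 < b) ∧ col b = col a := by
    by_cases hL : (f.filter fun p => p.1 < a).Nonempty
    · obtain ⟨q₀, hq₀⟩ := Finset.exists_maximalFor Prod.fst _ hL
      have hm : q₀ ∈ f ∧ q₀.1 < a := by simpa using hq₀.prop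
      obtain ⟨b, h1, h2, h3⟩ := h.exists_between q₀.2 p₀.2 a
        ((hf.lt_iff hm.1 hp₀).1 (hm.2.trans hap₀'))
      refine ⟨b, h2, fun q hq hqa => ?_, h3⟩
      have hle : q.1 ≤ q₀.1 := by
        rcases h.le_total_of_le q.1 q₀.1 a hqa.le hm.2.le with h4 | h4
        · exact h4
        · exact hq₀.le_of_le (by simp [hq, hqa]) h4
      exact ((hf.le_iff q hq q₀ hm.1).1 hle).trans_lt h1
    · obtain ⟨b, h1, h2⟩ := h.exists_lt p₀.2 a
      refine ⟨b, h1, fun q hq hqa => (hL ⟨q, by simp [hq, hqa]⟩).elim, h2⟩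
  have hcmp : ∀ q ∈ f, q.1 ≤ p₀.1 → q.1 < a ∨ a < q.1 := fun q hq hle =>
    (h.le_total_of_le q.1 a p₀.1 hle hap₀).imp (fun h1 => lt_of_le_of_ne h1 (hne q hq))
      (fun h1 => lt_of_le_of_ne h1 (hne q hq).symm)
  have hup : ∀ p ∈ f, a ≤ p.1 ↔ b ≤ p.2 := by
    intro p hp
    constructor
    · intro hap
      exact hb1.le.trans ((hf.le_iff p₀ hp₀ p hp).1 (hmin p hp hap))
    · intro hbp
      have hd := hf.inf_mem p hp p₀ hp₀
      rcases hcmp _ hd inf_le_right with h1 | h1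
      · exact absurd (hb2 _ hd h1) (not_lt_of_ge (le_inf hbp hb1.le))
      · exact h1.le.trans inf_le_left
  have hdn : ∀ p ∈ f, p.1 ≤ a ↔ p.2 ≤ b := by
    intro p hp
    constructor
    · intro hpa
      exact (hb2 p hp (lt_of_le_of_ne hpa (hne p hp))).le
    · intro hpb
      have hle := (hf.le_iff p hp p₀ hp₀).2 (hpb.trans hb1.le)
      rcases hcmp p hp hle with h1 | h1
      · exact h1.le
      · have := (hf.le_iff p₀ hp₀ p hp).1 (hmin p hp h1.le)
        exact absurd hb1 (not_lt_of_ge (this.trans hpb))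
  refine ⟨b, hf.insert_pair hb3.symm hup hdn fun p hp => ?_⟩
  by_cases hap : a ≤ p.1
  · rw [inf_eq_left.2 hap, inf_eq_left.2 ((hup p hp).1 hap)]
    exact Finset.mem_insert_self _ _
  · have hd := hf.inf_mem p hp p₀ hp₀
    have h1 : p.1 ⊓ p₀.1 ≤ a := by
      rcases hcmp _ hd inf_le_right with h1 | h1
      · exact h1.le
      · exact absurd (h1.le.trans inf_le_left) hap
    have h2 : p.2 ⊓ p₀.2 ≤ b := (hdn _ hd).1 h1
    have e1 : a ⊓ p.1 = p.1 ⊓ p₀.1 :=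
      le_antisymm (le_inf inf_le_right (inf_le_left.trans hap₀)) (le_inf h1 inf_le_left)
    have e2 : b ⊓ p.2 = p.2 ⊓ p₀.2 :=
      le_antisymm (le_inf inf_le_right (inf_le_left.trans hb1.le)) (le_inf h2 inf_le_left)
    rw [e1, e2]
    exact Finset.mem_insert_of_mem hd

/-- Here `a` opens a cone at `m` containing no domain point. Since `m` and `m'` have equally many
cones, counting yields a cone at `m'` free of range points, even when there are infinitely many
cones. -/
theorem exists_fresh (h : IsRichTree col) (hf : IsPartialTreeIso col f) {a m m' : α}
    (hm : (m, m') ∈ f) (hma : m < a) (hmax : ∀ p ∈ f, a ⊓ p.1 ≤ m) :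
    ∃ b, m' < b ∧ col b = col a ∧ ∀ p ∈ f, b ⊓ p.2 ≤ m' := by
  classical
  have hinf : ∀ p ∈ f, ∀ q ∈ f, m < p.1 ⊓ q.1 ↔ m' < p.2 ⊓ q.2 := fun p hp q hq =>
    hf.lt_iff hm (hf.inf_mem p hp q hq)
  obtain ⟨z, hz, hzf⟩ : ∃ z, m' < z ∧ ∀ p ∈ f, m' < p.2 → treeCone m' z ≠ treeCone m' p.2 := by
    by_contra! hcon
    -- The cones at `m` that meet the domain form a finite proper subset of all cones. If every cone
    -- at `m'` met the range, pulling back would inject the cones at `m'` into `S`.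
    set S : Set (Set α) := (fun p : α × α => treeCone m p.1) '' {p | p ∈ f ∧ m < p.1} with hS
    have hSfin : S.Finite := (f.finite_toSet.subset fun p hp => hp.1).image _
    have hSsub : S ⊂ treeCones m := by
      refine ssubset_iff_of_subset ?_ |>.2 ⟨treeCone m a, ⟨a, hma, rfl⟩, ?_⟩
      · rintro _ ⟨p, hp, rfl⟩
        exact ⟨p.1, hp.2, rfl⟩
      · rintro ⟨p, hp, hpa⟩
        have := lt_inf_of_treeCone_eq hma hpa
        rw [inf_comm] at this
        exact absurd this (not_lt_of_ge (hmax p hp.1))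
    have hlt := hSfin.encard_lt_encard hSsub
    rw [h.encard_cones m m' (hf.col_eq _ hm)] at hlt
    have hex : ∀ C ∈ treeCones m', ∃ p ∈ f, m' < p.2 ∧ C = treeCone m' p.2 := by
      rintro _ ⟨z, hz, rfl⟩
      exact hcon z hz
    have : Nonempty (α × α) := ⟨(m, m')⟩
    choose! F hF1 hF2 hF3 using hex
    have hF2' : ∀ C ∈ treeCones m', m < (F C).1 := fun C hC =>
      (hf.lt_iff hm (hF1 C hC)).2 (hF2 C hC)
    refine absurd hlt (not_lt_of_ge (Set.encard_le_encard_of_injOn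
      (f := fun C => treeCone m (F C).1) ?_ ?_))
    · intro C hC
      exact ⟨F C, ⟨hF1 C hC, hF2' C hC⟩, rfl⟩
    · intro C hC D hD hCD
      have := lt_inf_of_treeCone_eq (hF2' D hD) hCD
      rw [hF3 C hC, hF3 D hD]
      exact h.treeCone_eq ((hinf _ (hF1 C hC) _ (hF1 D hD)).1 this)
  obtain ⟨b, hb1, hb2, hb3⟩ := h.exists_between m' z a hz
  refine ⟨b, hb1, hb3, fun p hp => ?_⟩
  rcases h.le_total_of_le (b ⊓ p.2) m' b inf_le_left hb1.le with h1 | h1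
  · exact h1
  · rcases h1.eq_or_lt with h2 | h2
    · exact h2.ge
    · exact absurd (h.treeCone_eq (h2.trans_le (inf_le_inf_right _ hb2.le)))
        (hzf p hp (h2.trans_le inf_le_right))

/-- If `a` is below no domain element, first add the highest point `m` at which `a` leaves the
domain tree; then `a` lies in a fresh cone at `m`. -/
theorem exists_extend_left [DecidableEq α] (h : IsRichTree col) (hf : IsPartialTreeIso col f)
    (a : α) : ∃ g, IsPartialTreeIso col g ∧ f ⊆ g ∧ ∃ b, (a, b) ∈ g := by
  by_cases ha : ∃ p ∈ f, a ≤ p.1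
  · obtain ⟨b, hb⟩ := hf.exists_insert_of_le h ha
    exact ⟨_, hb, Finset.subset_insert _ _, b, Finset.mem_insert_self _ _⟩
  obtain ⟨p₀, hp₀⟩ := Finset.exists_maximalFor (fun p : α × α => a ⊓ p.1) f hf.nonempty
  have hmax : ∀ p ∈ f, a ⊓ p.1 ≤ a ⊓ p₀.1 := by
    intro p hp
    rcases h.le_total_of_le (a ⊓ p.1) (a ⊓ p₀.1) a inf_le_left inf_le_left with h1 | h1
    · exact h1
    · exact hp₀.le_of_le hp h1
  set m := a ⊓ p₀.1 with hm
  obtain ⟨m', hg⟩ := hf.exists_insert_of_le h ⟨p₀, hp₀.prop, (inf_le_right : m ≤ p₀.1)⟩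
  have hma : m < a := lt_of_le_of_ne inf_le_left
    fun he => ha ⟨p₀, hp₀.prop, he ▸ inf_le_right⟩
  have hmem := Finset.mem_insert_self (m, m') f
  have hmax' : ∀ p ∈ insert (m, m') f, a ⊓ p.1 ≤ m := by
    intro p hp
    rw [Finset.mem_insert] at hp
    rcases hp with rfl | hp
    · exact inf_le_right
    · exact hmax p hp
  obtain ⟨b, hb1, hb2, hb3⟩ := hg.exists_fresh h hmem hma hmax'
  refine ⟨_, hg.insert_pair (a := a) (b := b) hb2.symm ?_ ?_ ?_,
    (Finset.subset_insert _ _).trans (Finset.subset_insert _ _), b, Finset.mem_insert_self _ _⟩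
  · intro p hp
    constructor
    · intro hap
      exact absurd ((le_inf le_rfl hap).trans (hmax' p hp)) (not_le_of_gt hma)
    · intro hap
      exact absurd ((le_inf le_rfl hap).trans (hb3 p hp)) (not_le_of_gt hb1)
  · intro p hp
    constructor
    · intro hpa
      exact ((hg.le_iff p hp _ hmem).1 ((le_inf hpa le_rfl).trans (hmax' p hp))).trans hb1.le
    · intro hpa
      exact ((hg.le_iff p hp _ hmem).2 ((le_inf hpa le_rfl).trans (hb3 p hp))).trans hma.le
  · intro p hp
    have e1 : a ⊓ p.1 = m ⊓ p.1 :=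
      le_antisymm (le_inf (hmax' p hp) inf_le_right) (inf_le_inf_right _ hma.le)
    have e2 : b ⊓ p.2 = m' ⊓ p.2 :=
      le_antisymm (le_inf (hb3 p hp) inf_le_right) (inf_le_inf_right _ hb1.le)
    rw [e1, e2]
    exact Finset.mem_insert_of_mem (hg.inf_mem _ hmem p hp)

theorem exists_extend_right [DecidableEq α] (h : IsRichTree col) (hf : IsPartialTreeIso col f)
    (b : α) : ∃ g, IsPartialTreeIso col g ∧ f ⊆ g ∧ ∃ a, (a, b) ∈ g := by
  obtain ⟨g, hg, hfg, a, ha⟩ := hf.swap.exists_extend_left h b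
  refine ⟨g.image Prod.swap, hg.swap, fun p hp => ?_, a, ?_⟩
  · exact Finset.mem_image.2 ⟨p.swap, hfg (Finset.mem_image_of_mem _ hp), Prod.swap_swap p⟩
  · exact Finset.mem_image.2 ⟨(b, a), ha, rfl⟩

/-- An ideal meeting the countably many cofinal sets "`a` is in the domain" and "`b` is in the
range" is directed, so any two of its pairs lie in one finite partial isomorphism. Antisymmetry
makes the two resulting maps mutually inverse. -/
theorem exists_orderIso [Countable α] (h : IsRichTree col) (hf : IsPartialTreeIso col f) :
    ∃ σ : α ≃o α, ∀ p ∈ f, σ p.1 = p.2 := by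
  classical
  cases nonempty_encodable α
  let Q := {g : Finset (α × α) // IsPartialTreeIso col g}
  let D : α ⊕ α → Order.Cofinal Q := fun s => Sum.recOn s
    (fun a => ⟨{g | ∃ b, (a, b) ∈ g.1}, fun g => by
      obtain ⟨g', h1, h2, h3⟩ := g.2.exists_extend_left h a
      exact ⟨⟨g', h1⟩, h3, h2⟩⟩)
    (fun b => ⟨{g | ∃ a, (a, b) ∈ g.1}, fun g => by
      obtain ⟨g', h1, h2, h3⟩ := g.2.exists_extend_right h b
      exact ⟨⟨g', h1⟩, h3, h2⟩⟩)
  let I : Order.Ideal Q := Order.idealOfCofinals ⟨f, hf⟩ D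
  have hl : ∀ a, ∃ b, ∃ g ∈ I, (a, b) ∈ g.1 := by
    intro a
    obtain ⟨g, ⟨b, hb⟩, hg⟩ := Order.cofinal_meets_idealOfCofinals ⟨f, hf⟩ D (Sum.inl a)
    exact ⟨b, g, hg, hb⟩
  have hr : ∀ b, ∃ a, ∃ g ∈ I, (a, b) ∈ g.1 := by
    intro b
    obtain ⟨g, ⟨a, ha⟩, hg⟩ := Order.cofinal_meets_idealOfCofinals ⟨f, hf⟩ D (Sum.inr b)
    exact ⟨a, g, hg, ha⟩
  have hle : ∀ a b a' b', (∃ g ∈ I, (a, b) ∈ g.1) → (∃ g ∈ I, (a', b') ∈ g.1) →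
      (a ≤ a' ↔ b ≤ b') := by
    rintro a b a' b' ⟨g, hg, hab⟩ ⟨g', hg', hab'⟩
    obtain ⟨k, -, h1, h2⟩ := I.directed g hg g' hg'
    exact k.2.le_iff _ (h1 hab) _ (h2 hab')
  choose F hF using hl
  choose G hG using hr
  refine ⟨{ toFun := F, invFun := G, left_inv := fun a => ?_, right_inv := fun b => ?_,
            map_rel_iff' := fun {a a'} => (hle _ _ _ _ (hF a) (hF a')).symm }, fun p hp => ?_⟩
  · have h1 := hle _ _ _ _ (hG (F a)) (hF a)
    have h2 := hle _ _ _ _ (hF a) (hG (F a))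
    exact le_antisymm (h1.2 le_rfl) (h2.2 le_rfl)
  · have h1 := hle _ _ _ _ (hF (G b)) (hG b)
    have h2 := hle _ _ _ _ (hG b) (hF (G b))
    exact le_antisymm (h1.1 le_rfl) (h2.1 le_rfl)
  · have hpI : ∃ g ∈ I, (p.1, p.2) ∈ g.1 := ⟨⟨f, hf⟩, Order.mem_idealOfCofinals _ _, hp⟩
    have h1 := hle _ _ _ _ (hF p.1) hpI
    have h2 := hle _ _ _ _ hpI (hF p.1)
    exact le_antisymm (h1.1 le_rfl) (h2.1 le_rfl)

end IsPartialTreeIso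

/-- Two comparable pairs with the same colours are conjugate under an order automorphism. -/
theorem IsRichTree.exists_orderIso_pair [Countable α] (h : IsRichTree col) {a b a' b' : α}
    (hab : a < b) (hab' : a' < b') (ha : col a = col a') (hb : col b = col b') :
    ∃ σ : α ≃o α, σ a = a' ∧ σ b = b' := by
  classical
  have hf : IsPartialTreeIso col {(a, a'), (b, b')} := by
    refine ⟨by simp, ?_, ?_, ?_⟩
    · simp [hab.le, hab'.le, hab.not_ge, hab'.not_ge]
    · simp [inf_eq_left.2 hab.le, inf_eq_left.2 hab'.le, inf_eq_right.2 hab.le,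
        inf_eq_right.2 hab'.le]
      exact Or.inl ⟨hab.le, hab'.le⟩
    · simp [ha, hb]
  obtain ⟨σ, hσ⟩ := hf.exists_orderIso h
  exact ⟨σ, hσ (a, a') (by simp), hσ (b, b') (by simp)⟩

end ColouredTree

/-! ### Compact locally connected metric spaces are locally path connected -/

section CoarsePaths

variable {X : Type*} [MetricSpace X]

/-- `f` oscillates by less than `δ` near every point of `s`. -/
def CoarselyContinuousOn (δ : ℝ) (f : ℝ → X) (s : Set ℝ) : Prop :=
  ∀ t ∈ s, ∀ᶠ u in 𝓝[s] t, dist (f u) (f t) < δ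

/-- There is a coarsely continuous map on `[u, v]` from `a` to `b` subject to the constraint `S`. -/
def CoarselyJoined (δ : ℝ) (S : ℝ → Set X) (u v : ℝ) (a b : X) : Prop :=
  ∃ f : ℝ → X, f u = a ∧ f v = b ∧ CoarselyContinuousOn δ f (Icc u v) ∧ ∀ s ∈ Icc u v, f s ∈ S s

theorem CoarselyJoined.mono {δ : ℝ} {S S' : ℝ → Set X} {u v : ℝ} {a b : X}
    (h : CoarselyJoined δ S u v a b) (hS : ∀ s ∈ Icc u v, S s ⊆ S' s) :
    CoarselyJoined δ S' u v a b := by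
  obtain ⟨f, h1, h2, h3, h4⟩ := h
  exact ⟨f, h1, h2, h3, fun s hs => hS s hs (h4 s hs)⟩

theorem CoarselyJoined.trans {δ : ℝ} {S : ℝ → Set X} {u v w : ℝ} {a b c : X}
    (huv : u ≤ v) (hvw : v ≤ w)
    (h : CoarselyJoined δ S u v a b) (h' : CoarselyJoined δ S v w b c) :
    CoarselyJoined δ S u w a c := by
  obtain ⟨f, hf1, hf2, hf3, hf4⟩ := h
  obtain ⟨g, hg1, hg2, hg3, hg4⟩ := h'
  set k : ℝ → X := fun s => if s ≤ v then f s else g s with hk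
  have hkf : ∀ s ≤ v, k s = f s := fun s hs => if_pos hs
  have hkg : ∀ s, v ≤ s → k s = g s := by
    intro s hs
    rcases hs.eq_or_lt with rfl | hs
    · rw [hkf v le_rfl, hf2, hg1]
    · exact if_neg (not_le_of_gt hs)
  refine ⟨k, by rw [hkf u huv, hf1], by rw [hkg w hvw, hg2], ?_, ?_⟩
  · intro t ht
    have hsplit : Icc u w = Icc u v ∪ Icc v w := (Icc_union_Icc_eq_Icc huv hvw).symm
    rw [hsplit, nhdsWithin_union, Filter.eventually_sup]
    constructor
    · rcases le_or_gt t v with htv | htv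
      · filter_upwards [hf3 t ⟨ht.1, htv⟩, self_mem_nhdsWithin] with s hs hs'
        rw [hkf s hs'.2, hkf t htv]
        exact hs
      · have : 𝓝[Icc u v] t = ⊥ := by
          rw [← notMem_closure_iff_nhdsWithin_eq_bot, closure_Icc]
          exact fun h => absurd h.2 (not_le_of_gt htv)
        rw [this]
        exact Filter.eventually_bot
    · rcases le_or_gt v t with htv | htv
      · filter_upwards [hg3 t ⟨htv, ht.2⟩, self_mem_nhdsWithin] with s hs hs'
        rw [hkg s hs'.1, hkg t htv]
        exact hs
      · have : 𝓝[Icc v w] t = ⊥ := by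
          rw [← notMem_closure_iff_nhdsWithin_eq_bot, closure_Icc]
          exact fun h => absurd h.1 (not_le_of_gt htv)
        rw [this]
        exact Filter.eventually_bot
  · intro s hs
    rcases le_or_gt s v with h | h
    · rw [hkf s h]
      exact hf4 s ⟨hs.1, h⟩
    · rw [hkg s h.le]
      exact hg4 s ⟨h.le, hs.2⟩

theorem coarselyJoined_of_dist_lt {δ : ℝ} {S : ℝ → Set X} {u v : ℝ} {a b : X} (huv : u < v)
    (hab : dist a b < δ) (ha : ∀ s ∈ Icc u v, a ∈ S s) (hb : ∀ s ∈ Icc u v, b ∈ S s) :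
    CoarselyJoined δ S u v a b := by
  classical
  have hδ : 0 < δ := dist_nonneg.trans_lt hab
  refine ⟨fun s => if s < v then a else b, if_pos huv, if_neg (lt_irrefl v), ?_, ?_⟩
  · intro t _
    refine Filter.Eventually.of_forall fun s => ?_
    dsimp only
    split_ifs
    · simpa using hδ
    · exact hab
    · rwa [dist_comm]
    · simpa using hδ
  · intro s hs
    dsimp only
    split_ifs
    · exact ha s hs
    · exact hb s hs

theorem coarselyJoined_refl {δ : ℝ} (hδ : 0 < δ) {S : ℝ → Set X} {u v : ℝ} {a : X}
    (ha : ∀ s ∈ Icc u v, a ∈ S s) : CoarselyJoined δ S u v a a :=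
  ⟨fun _ => a, rfl, rfl, fun _ _ => Filter.Eventually.of_forall fun _ => by simpa using hδ, ha⟩

/-- Being joined by a coarse path holds between nearby points and is transitive, so it holds
throughout a connected set. -/
theorem IsPreconnected.coarselyJoined {K : Set X} (hK : IsPreconnected K) {δ : ℝ} (hδ : 0 < δ)
    {a b : X} (ha : a ∈ K) (hb : b ∈ K) {u v : ℝ} (huv : u < v) :
    CoarselyJoined δ (fun _ => K) u v a b := by
  refine hK.induction₂' (fun a b => ∀ u v : ℝ, u < v → CoarselyJoined δ (fun _ => K) u v a b)
    ?_ ?_ ha hb u v huv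
  · intro x hx
    filter_upwards [self_mem_nhdsWithin, mem_nhdsWithin_of_mem_nhds (Metric.ball_mem_nhds x hδ)]
      with y hy hyx
    rw [Metric.mem_ball] at hyx
    exact ⟨fun u v huv => coarselyJoined_of_dist_lt huv (by rwa [dist_comm])
      (fun _ _ => hx) (fun _ _ => hy), fun u v huv => coarselyJoined_of_dist_lt huv hyx
      (fun _ _ => hy) (fun _ _ => hx)⟩
  · intro x y z _ _ _ h1 h2 u v huv
    exact (h1 u ((u + v) / 2) (by linarith)).trans (by linarith) (by linarith)
      (h2 ((u + v) / 2) v (by linarith))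

theorem exists_uniform_isPreconnected [CompactSpace X] [LocallyConnectedSpace X] {ε : ℝ}
    (hε : 0 < ε) : ∃ δ > 0, ∀ a b : X, dist a b < δ →
      ∃ K, IsPreconnected K ∧ a ∈ K ∧ b ∈ K ∧ K ⊆ Metric.ball a ε := by
  have hc : ∀ p : X, ∃ V : Set X, V ⊆ Metric.ball p (ε / 2) ∧ IsOpen V ∧ p ∈ V ∧ IsConnected V :=
    fun p => locallyConnectedSpace_iff_subsets_isOpen_isConnected.1 inferInstance p _
      (Metric.ball_mem_nhds p (half_pos hε))
  choose V hV1 hV2 hV3 hV4 using hc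
  obtain ⟨δ, hδ, hcov⟩ := lebesgue_number_lemma_of_metric (isCompact_univ (X := X)) hV2
    (fun p _ => mem_iUnion.2 ⟨p, hV3 p⟩)
  refine ⟨δ, hδ, fun a b hab => ?_⟩
  obtain ⟨p, hp⟩ := hcov a trivial
  have ha : a ∈ V p := hp (Metric.mem_ball_self hδ)
  refine ⟨V p, (hV4 p).isPreconnected, ha, hp (by rwa [Metric.mem_ball, dist_comm]), ?_⟩
  intro x hx
  have h1 := hV1 p hx
  have h2 := hV1 p ha
  rw [Metric.mem_ball] at *
  rw [dist_comm] at h2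
  linarith [dist_triangle x p a]

/-- On each interval of a fine subdivision the coarse path is replaced by a finer one running inside
a small connected set that contains both end values. -/
theorem exists_coarse_refinement [CompactSpace X] [LocallyConnectedSpace X] {ε : ℝ}
    (hε : 0 < ε) : ∃ δ > 0, δ ≤ ε ∧ ∀ f : ℝ → X, CoarselyContinuousOn δ f (Icc 0 1) →
      ∀ δ' > 0, ∃ g : ℝ → X, CoarselyContinuousOn δ' g (Icc 0 1) ∧ g 0 = f 0 ∧ g 1 = f 1 ∧
        ∀ s ∈ Icc (0 : ℝ) 1, dist (f s) (g s) ≤ ε := by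
  obtain ⟨δ, hδ, hK⟩ := exists_uniform_isPreconnected (X := X) (half_pos hε)
  -- Values of `f` on one subinterval are within `2 * η` of the left value: at most `δ`, so the
  -- connected set exists, and at most `ε / 2`, which with its radius `ε / 2` gives `ε`.
  set η := min (δ / 2) (ε / 4) with hη
  have hη1 : η ≤ δ / 2 := min_le_left _ _
  have hη2 : η ≤ ε / 4 := min_le_right _ _
  have hη0 : 0 < η := lt_min (by linarith) (by linarith)
  refine ⟨η, hη0, by linarith, fun f hf δ' hδ' => ?_⟩
  have hO : ∀ t : Icc (0 : ℝ) 1, ∃ O : Set ℝ, IsOpen O ∧ t.1 ∈ O ∧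
      ∀ s ∈ O ∩ Icc 0 1, dist (f s) (f t) < η := by
    intro t
    obtain ⟨O, h1, h2, h3⟩ := mem_nhdsWithin.1 (hf t t.2)
    exact ⟨O, h1, h2, h3⟩
  choose O hO1 hO2 hO3 using hO
  obtain ⟨t, ht0, htm, ⟨m, ht1⟩, htc⟩ := exists_monotone_Icc_subset_open_cover_Icc
    (zero_le_one' ℝ) (c := fun t => Subtype.val ⁻¹' (O t))
    (fun t => (hO1 t).preimage continuous_subtype_val) (fun t _ => mem_iUnion.2 ⟨t, hO2 t⟩)
  set S : ℝ → Set X := fun s => Metric.closedBall (f s) ε with hS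
  have step : ∀ n, CoarselyJoined δ' S (t n) (t (n + 1)) (f (t n)) (f (t (n + 1))) := by
    intro n
    obtain ⟨i, hi⟩ := htc n
    have hd : ∀ s ∈ Icc (t n : ℝ) (t (n + 1)), dist (f s) (f i) < η := by
      intro s hs
      have hs' : s ∈ Icc (0 : ℝ) 1 := ⟨(t n).2.1.trans hs.1, hs.2.trans (t (n + 1)).2.2⟩
      exact hO3 i s ⟨hi (show (⟨s, hs'⟩ : Icc (0 : ℝ) 1) ∈ Icc (t n) (t (n + 1)) from hs), hs'⟩
    have hle : (t n : ℝ) ≤ t (n + 1) := htm n.le_succ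
    have hn := hd _ (left_mem_Icc.2 hle)
    have hd' : ∀ s ∈ Icc (t n : ℝ) (t (n + 1)), dist (f (t n)) (f s) < 2 * η := by
      intro s hs
      have := hd s hs
      rw [dist_comm] at this
      linarith [dist_triangle (f (t n)) (f i) (f s)]
    rcases hle.eq_or_lt with he | hlt
    · rw [← he]
      refine coarselyJoined_refl hδ' fun s hs => ?_
      rw [Icc_self, mem_singleton_iff] at hs
      rw [hs]
      exact Metric.mem_closedBall_self hε.le
    · obtain ⟨K, hK1, hK2, hK3, hK4⟩ := hK (f (t n)) (f (t (n + 1)))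
        (by linarith [hd' _ (right_mem_Icc.2 hle)])
      refine (hK1.coarselyJoined hδ' hK2 hK3 hlt).mono fun s hs x hx => ?_
      have h1 := hK4 hx
      rw [Metric.mem_ball] at h1
      rw [hS, Metric.mem_closedBall]
      linarith [dist_triangle x (f (t n)) (f s), hd' s hs]
  have hall : ∀ n, CoarselyJoined δ' S 0 (t n) (f 0) (f (t n)) := by
    intro n
    induction n with
    | zero =>
      rw [ht0]
      refine coarselyJoined_refl hδ' fun s hs => ?_
      rw [Icc_self, mem_singleton_iff] at hs
      rw [hs]
      exact Metric.mem_closedBall_self hε.le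
    | succ n ih => exact ih.trans (t n).2.1 (htm n.le_succ) (step n)
  have h1 := hall m
  rw [ht1 m le_rfl] at h1
  obtain ⟨g, hg1, hg2, hg3, hg4⟩ := h1
  refine ⟨g, hg3, hg1, hg2, fun s hs => ?_⟩
  rw [dist_comm]
  exact hg4 s hs

/-- Refining a two-valued step function with errors `C / 2 / 2 ^ n` gives a uniform limit within `C`
of `{a, b}`. The jumps allowed at stage `n` tend to zero, so the limit is continuous. -/
theorem exists_uniform_joinedIn [CompactSpace X] [LocallyConnectedSpace X] {C : ℝ}
    (hC : 0 < C) : ∃ δ > 0, ∀ a b : X, dist a b < δ → JoinedIn (Metric.closedBall a (2 * C)) a b := by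
  have hε : ∀ n : ℕ, 0 < C / 2 / 2 ^ n := fun n => by positivity
  choose δ hδ0 hδε hδ using fun n => exists_coarse_refinement (X := X) (hε n)
  refine ⟨δ 0, hδ0 0, fun a b hab => ?_⟩
  let Q : ℕ → Type _ := fun n =>
    {f : ℝ → X // CoarselyContinuousOn (δ n) f (Icc 0 1) ∧ f 0 = a ∧ f 1 = b}
  obtain ⟨f₀, hf₀0, hf₀1, hf₀c, hf₀S⟩ := coarselyJoined_of_dist_lt (S := fun _ => {a, b})
    zero_lt_one hab (fun _ _ => mem_insert _ _) (fun _ _ => mem_insert_of_mem _ rfl)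
  have hstep : ∀ n (f : Q n), ∃ g : Q (n + 1), ∀ s ∈ Icc (0 : ℝ) 1,
      dist (f.1 s) (g.1 s) ≤ C / 2 / 2 ^ n := by
    rintro n ⟨f, hf, hf0, hf1⟩
    obtain ⟨g, hg, hg0, hg1, hg2⟩ := hδ n f hf (δ (n + 1)) (hδ0 _)
    exact ⟨⟨g, hg, hg0.trans hf0, hg1.trans hf1⟩, hg2⟩
  choose G hG using hstep
  let F : ∀ n, Q n := fun n => Nat.rec ⟨f₀, hf₀c, hf₀0, hf₀1⟩ (fun n f => G n f) n
  have hF : ∀ n, ∀ s ∈ Icc (0 : ℝ) 1, dist ((F n).1 s) ((F (n + 1)).1 s) ≤ C / 2 / 2 ^ n :=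
    fun n => hG n (F n)
  have hlim : ∀ s : ℝ, ∃ x : X, s ∈ Icc (0 : ℝ) 1 →
      Filter.Tendsto (fun n => (F n).1 s) Filter.atTop (𝓝 x) := by
    intro s
    by_cases hs : s ∈ Icc (0 : ℝ) 1
    · obtain ⟨x, hx⟩ := cauchySeq_tendsto_of_complete
        (cauchySeq_of_le_geometric_two (fun n => hF n s hs))
      exact ⟨x, fun _ => hx⟩
    · exact ⟨a, fun h => (hs h).elim⟩
  choose f hf using hlim
  have hdist : ∀ n, ∀ s ∈ Icc (0 : ℝ) 1, dist ((F n).1 s) (f s) ≤ C / 2 ^ n := fun n s hs =>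
    dist_le_of_le_geometric_two_of_tendsto (fun n => hF n s hs) (hf s hs) n
  have hend : ∀ s ∈ Icc (0 : ℝ) 1, ∀ c, (∀ n, (F n).1 s = c) → f s = c := by
    intro s hs c hc
    have h1 := hf s hs
    simp only [hc] at h1
    exact tendsto_nhds_unique h1 tendsto_const_nhds
  refine JoinedIn.ofLine (f := f) ?_ ?_ ?_ ?_
  · intro t ht
    rw [ContinuousWithinAt, Metric.tendsto_nhds]
    intro e he
    obtain ⟨n, hn⟩ : ∃ n : ℕ, C / 2 ^ n < e / 3 := by
      obtain ⟨n, hn⟩ := pow_unbounded_of_one_lt (C / (e / 3)) one_lt_two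
      refine ⟨n, ?_⟩
      rw [div_lt_iff₀ (by positivity)] at hn ⊢
      linarith
    have h2 : δ n ≤ e / 3 := by
      refine (hδε n).trans (le_trans ?_ hn.le)
      gcongr
      linarith
    filter_upwards [(F n).2.1 t ht, self_mem_nhdsWithin] with s hs hsI
    have h3 := hdist n s hsI
    have h4 := hdist n t ht
    rw [dist_comm] at h3
    linarith [dist_triangle4 (f s) ((F n).1 s) ((F n).1 t) (f t)]
  · exact hend 0 (by simp) a fun n => (F n).2.2.1
  · exact hend 1 (by simp) b fun n => (F n).2.2.2
  · rintro _ ⟨s, hs, rfl⟩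
    have h1 := hdist 0 s hs
    have h2 : dist (f₀ s) a ≤ C := by
      rcases hf₀S s hs with h | h
      · rw [h, dist_self]
        exact hC.le
      · rw [h, dist_comm]
        have := hδε 0
        simp only [pow_zero, div_one] at this
        linarith
    change dist (f₀ s) (f s) ≤ C / 2 ^ 0 at h1
    simp only [pow_zero, div_one] at h1
    rw [dist_comm] at h1
    rw [Metric.mem_closedBall]
    linarith [dist_triangle (f s) (f₀ s) a]

end CoarsePaths

theorem locallyPathConnectedSpace_of_compact_metrizable {X : Type*} [TopologicalSpace X]
    [TopologicalSpace.MetrizableSpace X] [CompactSpace X] [LocallyConnectedSpace X] :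
    LocallyPathConnectedSpace X := by
  let _ := TopologicalSpace.metrizableSpaceMetric X
  rw [locallyPathConnectedSpace_iff_pathComponentIn_mem_nhds]
  intro x U hU hx
  obtain ⟨e, he, heU⟩ := Metric.isOpen_iff.1 hU x hx
  obtain ⟨δ, hδ, h⟩ := exists_uniform_joinedIn (X := X) (C := e / 4) (by positivity)
  refine Filter.mem_of_superset (Metric.ball_mem_nhds x hδ) fun y hy => ?_
  rw [Metric.mem_ball, dist_comm] at hy
  refine (h x y hy).mono ((Metric.closedBall_subset_ball ?_).trans heU)
  linarith

/-! ### Every path contains an arc -/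

section ArcExtraction

/-- A closed subset of `[0, 1]` containing the endpoints such that the path `γ` takes the same
value at the two ends of each complementary interval. -/
structure IsGapSet {X : Type*} (γ : ℝ → X) (T : Set ℝ) : Prop where
  isClosed : IsClosed T
  subset : T ⊆ Icc 0 1
  zero_mem : (0 : ℝ) ∈ T
  one_mem : (1 : ℝ) ∈ T
  gap : ∀ t ∈ Icc (0 : ℝ) 1, t ∉ T → ∃ u ∈ T, ∃ v ∈ T, u < t ∧ t < v ∧
    (∀ s ∈ T, u < s → v ≤ s) ∧ γ u = γ v

theorem isGapSet_Icc {X : Type*} (γ : ℝ → X) : IsGapSet γ (Icc 0 1) where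
  isClosed := isClosed_Icc
  subset := Subset.rfl
  zero_mem := by simp
  one_mem := by simp
  gap := fun _ ht ht' => (ht' ht).elim

/-- By compactness some member of the chain already misses `[u + e, v - e]`, so its gap around `t`
has ends close to `u` and `v`, with equal values under `γ`. Hence `γ u` and `γ v` cannot be
separated. -/
theorem IsGapSet.sInter {X : Type*} [TopologicalSpace X] [T2Space X] {γ : ℝ → X}
    (hγ : Continuous γ) {c : Set (Set ℝ)} (hc : ∀ T ∈ c, IsGapSet γ T)
    (hchain : IsChain (· ⊆ ·) c) (hne : c.Nonempty) : IsGapSet γ (⋂₀ c) := by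
  obtain ⟨T₀, hT₀⟩ := hne
  have hcl : IsClosed (⋂₀ c) := isClosed_sInter fun T hT => (hc T hT).isClosed
  have h0 : (0 : ℝ) ∈ ⋂₀ c := fun T hT => (hc T hT).zero_mem
  have h1 : (1 : ℝ) ∈ ⋂₀ c := fun T hT => (hc T hT).one_mem
  have hsub : ⋂₀ c ⊆ Icc (0 : ℝ) 1 := (sInter_subset_of_mem hT₀).trans (hc T₀ hT₀).subset
  refine ⟨hcl, hsub, h0, h1, fun t ht htT => ?_⟩
  have hcu : IsCompact (⋂₀ c ∩ Icc 0 t) := isCompact_Icc.inter_left hcl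
  have hcv : IsCompact (⋂₀ c ∩ Icc t 1) := isCompact_Icc.inter_left hcl
  obtain ⟨u, ⟨huT, hut⟩, hu⟩ := hcu.exists_isGreatest ⟨0, h0, by simp [ht.1]⟩
  obtain ⟨v, ⟨hvT, hvt⟩, hv⟩ := hcv.exists_isLeast ⟨1, h1, by simp [ht.2]⟩
  have hut' : u < t := lt_of_le_of_ne hut.2 (by rintro rfl; exact htT huT)
  have hvt' : t < v := lt_of_le_of_ne hvt.1 (by rintro rfl; exact htT hvT)
  have hgap : ∀ s ∈ ⋂₀ c, u < s → v ≤ s := by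
    intro s hs hus
    rcases le_total s t with h | h
    · exact absurd (hu ⟨hs, (hsub hs).1, h⟩) (not_le_of_gt hus)
    · exact hv ⟨hs, h, (hsub hs).2⟩
  refine ⟨u, huT, v, hvT, hut', hvt', hgap, ?_⟩
  by_contra hne
  obtain ⟨A, B, hA, hB, hAu, hBv, hAB⟩ := t2_separation hne
  obtain ⟨e₁, he₁, heA⟩ := Metric.isOpen_iff.1 (hA.preimage hγ) u hAu
  obtain ⟨e₂, he₂, heB⟩ := Metric.isOpen_iff.1 (hB.preimage hγ) v hBv
  obtain ⟨e, he, hee₁, hee₂, heu, hev⟩ : ∃ e > 0, e ≤ e₁ ∧ e ≤ e₂ ∧ e ≤ t - u ∧ e ≤ v - t :=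
    ⟨min (min e₁ e₂) (min (t - u) (v - t)),
      lt_min (lt_min he₁ he₂) (lt_min (by linarith) (by linarith)),
      (min_le_left _ _).trans (min_le_left _ _), (min_le_left _ _).trans (min_le_right _ _),
      (min_le_right _ _).trans (min_le_left _ _), (min_le_right _ _).trans (min_le_right _ _)⟩
  obtain ⟨T, hT, hTZ⟩ : ∃ T ∈ c, Icc (u + e) (v - e) ∩ T = ∅ := by
    have : Nonempty c := ⟨⟨T₀, hT₀⟩⟩
    obtain ⟨T, hT⟩ := (isCompact_Icc (a := u + e) (b := v - e)).elim_directed_family_closed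
      (fun T : c => T.1) (fun T => (hc T T.2).isClosed) (by
        rw [← sInter_eq_iInter, eq_empty_iff_forall_notMem]
        rintro s ⟨hs1, hs2⟩
        have := hgap s hs2 (by linarith [hs1.1])
        linarith [hs1.2]) (by
        intro T T'
        rcases hchain.total T.2 T'.2 with h | h
        · exact ⟨T, Subset.rfl, h⟩
        · exact ⟨T', h, Subset.rfl⟩)
    exact ⟨T, T.2, hT⟩
  have hTZ' : ∀ s ∈ T, u + e ≤ s → v - e < s := by
    intro s hs hus
    by_contra! h
    exact (eq_empty_iff_forall_notMem.1 hTZ s) ⟨⟨hus, h⟩, hs⟩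
  obtain ⟨p, hp, q, hq, hpt, htq, hpq, hγpq⟩ := (hc T hT).gap t ht fun h => by
    have := hTZ' t h (by linarith)
    linarith
  have hup : u ≤ p := by
    by_contra! h
    have := hpq u (huT T hT) h
    linarith
  have hqv : q ≤ v := hpq v (hvT T hT) (hpt.trans hvt')
  have hpA : γ p ∈ A := heA <| by
    rw [Metric.mem_ball, Real.dist_eq, abs_lt]
    have : p < u + e := by
      by_contra! h
      have := hTZ' p hp h
      linarith
    constructor <;> linarith
  have hqB : γ q ∈ B := heB <| by
    rw [Metric.mem_ball, Real.dist_eq, abs_lt]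
    have := hTZ' q hq (by linarith)
    constructor <;> linarith
  exact hAB.le_bot ⟨hpA, hγpq ▸ hqB⟩

/-- If `γ p = γ q`, deleting the interval between them leaves a gap set, so by minimality nothing of
`T` lies there. Thus `γ` becomes injective on `T` once the ends of each gap are identified. -/
theorem exists_minimal_isGapSet {X : Type*} [TopologicalSpace X] [T2Space X] {γ : ℝ → X}
    (hγ : Continuous γ) : ∃ T, IsGapSet γ T ∧
      ∀ p ∈ T, ∀ q ∈ T, p < q → (γ p = γ q ↔ ∀ s ∈ T, p < s → q ≤ s) := by
  obtain ⟨T, hT⟩ := zorn_superset {T | IsGapSet γ T} (by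
    intro c hc hchain
    rcases c.eq_empty_or_nonempty with rfl | hne
    · exact ⟨Icc 0 1, isGapSet_Icc γ, by simp⟩
    · exact ⟨⋂₀ c, IsGapSet.sInter hγ (fun T hT => hc hT) hchain hne,
        fun T hT => sInter_subset_of_mem hT⟩)
  have hgT : IsGapSet γ T := hT.prop
  refine ⟨T, hgT, fun p hp q hq hpq => ⟨fun heq => ?_, fun hgap => ?_⟩⟩
  · have hsub : T \ Ioo p q ⊆ T := sdiff_subset
    have hg : IsGapSet γ (T \ Ioo p q) := by
      refine ⟨hgT.isClosed.sdiff isOpen_Ioo, hsub.trans hgT.subset,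
        ⟨hgT.zero_mem, fun h => absurd h.1 (not_lt_of_ge (hgT.subset hp).1)⟩,
        ⟨hgT.one_mem, fun h => absurd h.2 (not_lt_of_ge (hgT.subset hq).2)⟩, fun t ht htT => ?_⟩
      by_cases hto : t ∈ Ioo p q
      · refine ⟨p, ⟨hp, fun h => lt_irrefl _ h.1⟩, q, ⟨hq, fun h => lt_irrefl _ h.2⟩,
          hto.1, hto.2, fun s hs hps => ?_, heq⟩
        by_contra! h
        exact hs.2 ⟨hps, h⟩
      · have htT' : t ∉ T := fun h => htT ⟨h, hto⟩
        obtain ⟨u, hu, v, hv, hut, htv, huv, hγ⟩ := hgT.gap t ht htT'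
        refine ⟨u, ⟨hu, fun h => hto ⟨h.1.trans hut, ?_⟩⟩, v, ⟨hv, fun h => hto ⟨?_, htv.trans h.2⟩⟩,
          hut, htv, fun s hs => huv s hs.1, hγ⟩
        · exact htv.trans_le (huv q hq h.2)
        · by_contra! h'
          rcases h'.eq_or_lt with rfl | h'
          · exact htT' hp
          · exact absurd (huv p hp (hut.trans h')) (not_le_of_gt h.1)
    intro s hs hps
    by_contra! hsq
    exact (hT.le_of_le hg hsub hs).2 ⟨hps, hsq⟩
  · have hmid : (p + q) / 2 ∉ T := fun h => by
      have := hgap _ h (by linarith)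
      linarith
    have h0 := (hgT.subset hp).1
    have h1 := (hgT.subset hq).2
    obtain ⟨u, hu, v, hv, hut, htv, huv, hγ⟩ :=
      hgT.gap ((p + q) / 2) ⟨by linarith, by linarith⟩ hmid
    have e1 : u = p := by
      apply le_antisymm
      · by_contra! h
        have := hgap u hu h
        linarith
      · by_contra! h
        have := huv p hp h
        linarith
    have e2 : v = q := by
      apply le_antisymm
      · exact huv q hq (by linarith)
      · exact hgap v hv (by linarith)
    rw [← e1, ← e2]
    exact hγ

variable {X : Type*}

/-- The part of the path `γ` traversed along `T` up to time `t`. -/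
def pathTrace (γ : ℝ → X) (T : Set ℝ) (t : ℝ) : Set X := γ '' (T ∩ Icc 0 t)

variable {γ : ℝ → X} {T : Set ℝ}

theorem pathTrace_mono {s t : ℝ} (h : s ≤ t) : pathTrace γ T s ⊆ pathTrace γ T t :=
  image_mono (inter_subset_inter_right _ (Icc_subset_Icc_right h))

theorem IsGapSet.mem_pathTrace (hT : IsGapSet γ T) {t : ℝ} (ht : 0 ≤ t) :
    γ 0 ∈ pathTrace γ T t := ⟨0, ⟨hT.zero_mem, le_rfl, ht⟩, rfl⟩

variable [MetricSpace X]

/-- A point of the trace reached after time `s` is close to one reached before: if `s` falls in a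
gap, `γ` takes the same value at its two ends, so nothing jumps. -/
theorem IsGapSet.continuousOn_infDist (hT : IsGapSet γ T) (hγ : Continuous γ) (d : X) :
    ContinuousOn (fun t => Metric.infDist d (pathTrace γ T t)) (Icc 0 1) := by
  have huc := Metric.uniformContinuousOn_iff.1
    (isCompact_Icc.uniformContinuousOn_of_continuous (hγ.continuousOn (s := Icc 0 1)))
  rw [Metric.continuousOn_iff]
  intro t ht ε hε
  obtain ⟨δ, hδ, h⟩ := huc (ε / 2) (half_pos hε)
  have key : ∀ s ∈ Icc (0 : ℝ) 1, ∀ t ∈ Icc (0 : ℝ) 1, s ≤ t → t - s < δ →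
      Metric.infDist d (pathTrace γ T s) ≤ Metric.infDist d (pathTrace γ T t) + ε / 2 := by
    intro s hs t ht hst hδ'
    rw [← sub_le_iff_le_add, Metric.le_infDist ⟨_, hT.mem_pathTrace ht.1⟩]
    rintro _ ⟨r, ⟨hrT, hr⟩, rfl⟩
    rw [sub_le_iff_le_add]
    rcases le_or_gt r s with hrs | hrs
    · have := Metric.infDist_le_dist_of_mem (x := d)
        (show γ r ∈ pathTrace γ T s from ⟨r, ⟨hrT, hr.1, hrs⟩, rfl⟩)
      linarith
    · obtain ⟨u, hu, v, hv, hus, hsv, hvr, hγuv⟩ : ∃ u ∈ T, ∃ v ∈ T, u ≤ s ∧ s ≤ v ∧ v ≤ r ∧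
          γ u = γ v := by
        by_cases hsT : s ∈ T
        · exact ⟨s, hsT, s, hsT, le_rfl, le_rfl, hrs.le, rfl⟩
        · obtain ⟨u, hu, v, hv, h1, h2, h3, h4⟩ := hT.gap s hs hsT
          exact ⟨u, hu, v, hv, h1.le, h2.le, h3 r hrT (h1.trans hrs), h4⟩
      have h1 := Metric.infDist_le_dist_of_mem (x := d)
        (show γ u ∈ pathTrace γ T s from ⟨u, ⟨hu, (hT.subset hu).1, hus⟩, rfl⟩)
      have h2 := h r (hT.subset hrT) v (hT.subset hv) (by
        rw [Real.dist_eq, abs_lt]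
        constructor <;> linarith [hr.2])
      rw [hγuv] at h1
      linarith [dist_triangle d (γ r) (γ v)]
  have anti : ∀ s ∈ Icc (0 : ℝ) 1, ∀ t ∈ Icc (0 : ℝ) 1, s ≤ t →
      Metric.infDist d (pathTrace γ T t) ≤ Metric.infDist d (pathTrace γ T s) :=
    fun s hs t _ hst => Metric.infDist_le_infDist_of_subset (pathTrace_mono hst)
      ⟨_, hT.mem_pathTrace hs.1⟩
  refine ⟨δ, hδ, fun s hs hst => ?_⟩
  rw [Real.dist_eq, abs_lt] at hst ⊢
  rcases le_total s t with hle | hle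
  · have h1 := key s hs t ht hle (by linarith)
    have h2 := anti s hs t ht hle
    constructor <;> linarith
  · have h1 := key t ht s hs hle (by linarith)
    have h2 := anti t ht s hs hle
    constructor <;> linarith

/-- The height is a weighted sum of the distances from a dense sequence to the trace. If `γ p ≠ γ q`
with `p < q`, then `γ q` is outside the closed trace up to `p`, and a term with `d n` near `γ q`
drops strictly. -/
theorem IsGapSet.exists_strict_height [CompactSpace X] (hT : IsGapSet γ T) (hγ : Continuous γ)
    (hmin : ∀ p ∈ T, ∀ q ∈ T, p < q → (γ p = γ q ↔ ∀ s ∈ T, p < s → q ≤ s)) :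
    ∃ h : ℝ → ℝ, ContinuousOn h (Icc 0 1) ∧ AntitoneOn h (Icc 0 1) ∧
      ∀ p ∈ T, ∀ q ∈ T, h p = h q ↔ γ p = γ q := by
  have : Nonempty X := ⟨γ 0⟩
  set d := TopologicalSpace.denseSeq X with hd
  set m : ℕ → ℝ → ℝ := fun n t => Metric.infDist (d n) (pathTrace γ T t) with hm
  have hm0 : ∀ n t, 0 ≤ m n t := fun n t => Metric.infDist_nonneg
  have hmD : ∀ n, ∀ t ∈ Icc (0 : ℝ) 1, m n t ≤ Metric.diam (univ : Set X) := fun n t ht =>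
    (Metric.infDist_le_dist_of_mem (hT.mem_pathTrace ht.1)).trans
      (Metric.dist_le_diam_of_mem isCompact_univ.isBounded trivial trivial)
  have hbd : ∀ n, ∀ t ∈ Icc (0 : ℝ) 1,
      ‖(1 / 2 : ℝ) ^ n * m n t‖ ≤ (1 / 2 : ℝ) ^ n * Metric.diam (univ : Set X) := by
    intro n t ht
    rw [Real.norm_of_nonneg (mul_nonneg (by positivity) (hm0 n t))]
    exact mul_le_mul_of_nonneg_left (hmD n t ht) (by positivity)
  have hsum : Summable fun n : ℕ => (1 / 2 : ℝ) ^ n * Metric.diam (univ : Set X) :=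
    summable_geometric_two.mul_right _
  have hsm : ∀ t ∈ Icc (0 : ℝ) 1, Summable fun n => (1 / 2 : ℝ) ^ n * m n t := fun t ht =>
    Summable.of_norm_bounded hsum (fun n => hbd n t ht)
  have hanti : ∀ n, ∀ s ∈ Icc (0 : ℝ) 1, ∀ t ∈ Icc (0 : ℝ) 1, s ≤ t →
      (1 / 2 : ℝ) ^ n * m n t ≤ (1 / 2 : ℝ) ^ n * m n s := fun n s hs t _ hst =>
    mul_le_mul_of_nonneg_left (Metric.infDist_le_infDist_of_subset (pathTrace_mono hst)
      ⟨_, hT.mem_pathTrace hs.1⟩) (by positivity)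
  have hlt : ∀ p ∈ T, ∀ q ∈ T, p < q →
      ((∑' n, (1 / 2 : ℝ) ^ n * m n p) = (∑' n, (1 / 2 : ℝ) ^ n * m n q) ↔ γ p = γ q) := by
    intro p hp q hq hpq
    have hpI := hT.subset hp
    have hqI := hT.subset hq
    constructor
    · intro heq
      by_contra hne
      have hnot : γ q ∉ pathTrace γ T p := by
        rintro ⟨s, ⟨hs, hs'⟩, hsq⟩
        have h1 := (hmin s hs q hq (hs'.2.trans_lt hpq)).1 hsq
        rcases hs'.2.eq_or_lt with rfl | h2
        · exact hne hsq
        · exact absurd (h1 p hp h2) (not_le_of_gt hpq)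
      have hcomp : IsClosed (pathTrace γ T p) :=
        ((isCompact_Icc.inter_left hT.isClosed).image hγ).isClosed
      have hη := (hcomp.notMem_iff_infDist_pos ⟨_, hT.mem_pathTrace hpI.1⟩).1 hnot
      obtain ⟨_, ⟨n, rfl⟩, hn⟩ := Metric.mem_closure_iff.1
        (TopologicalSpace.denseRange_denseSeq X (γ q)) _ (half_pos hη)
      have h1 : m n q ≤ dist (d n) (γ q) :=
        Metric.infDist_le_dist_of_mem ⟨q, ⟨hq, hqI.1, le_rfl⟩, rfl⟩
      have h2 : Metric.infDist (γ q) (pathTrace γ T p) ≤ m n p + dist (γ q) (d n) :=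
        Metric.infDist_le_infDist_add_dist
      have h3 : m n q < m n p := by
        rw [dist_comm] at h1
        change dist (γ q) (d n) < _ at hn
        linarith
      refine absurd heq (ne_of_gt (Summable.tsum_lt_tsum (i := n)
        (fun k => hanti k p hpI q hqI hpq.le) ?_ (hsm q hqI) (hsm p hpI)))
      exact mul_lt_mul_of_pos_left h3 (by positivity)
    · intro heq
      have hgap := (hmin p hp q hq hpq).1 heq
      have : pathTrace γ T p = pathTrace γ T q := by
        refine (pathTrace_mono hpq.le).antisymm ?_
        rintro _ ⟨s, ⟨hs, hs'⟩, rfl⟩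
        rcases le_or_gt s p with h | h
        · exact ⟨s, ⟨hs, hs'.1, h⟩, rfl⟩
        · rw [le_antisymm hs'.2 (hgap s hs h), ← heq]
          exact ⟨p, ⟨hp, hpI.1, le_rfl⟩, rfl⟩
      simp only [hm, this]
  refine ⟨fun t => ∑' n, (1 / 2 : ℝ) ^ n * m n t, ?_, ?_, ?_⟩
  · exact continuousOn_tsum (fun n => continuousOn_const.mul (hT.continuousOn_infDist hγ (d n)))
      hsum hbd
  · intro s hs t ht hst
    exact Summable.tsum_le_tsum (fun n => hanti n s hs t ht hst) (hsm t ht) (hsm s hs)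
  · intro p hp q hq
    rcases lt_trichotomy p q with h | rfl | h
    · exact hlt p hp q hq h
    · simp
    · rw [eq_comm, hlt q hq p hp h, eq_comm]

/-- The normalised height maps `T` onto `[0, 1]` with the same fibres as `γ`. It is a quotient map
by compactness, so `γ` descends to an embedding of `[0, 1]`. -/
theorem exists_isArcBetween_subset_image [CompactSpace X] (hγ : Continuous γ) (hne : γ 0 ≠ γ 1) :
    ∃ A ⊆ γ '' Icc 0 1, IsArcBetween A (γ 0) (γ 1) := by
  obtain ⟨T, hT, hmin⟩ := exists_minimal_isGapSet hγ
  obtain ⟨h, hcont, hanti, heq⟩ := hT.exists_strict_height hγ hmin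
  have hlt : h 1 < h 0 := lt_of_le_of_ne (hanti (by simp) (by simp) zero_le_one)
    fun he => hne ((heq 0 hT.zero_mem 1 hT.one_mem).1 he.symm)
  have hpos : 0 < h 0 - h 1 := sub_pos.2 hlt
  have hmem : ∀ t : T, (h 0 - h t) / (h 0 - h 1) ∈ unitInterval := by
    intro t
    have ht := hT.subset t.2
    have h1 := hanti (by simp) ht ht.1
    have h2 := hanti ht (by simp) ht.2
    exact ⟨div_nonneg (by linarith) hpos.le, (div_le_one hpos).2 (by linarith)⟩
  let k : T → unitInterval := fun t => ⟨_, hmem t⟩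
  have hk : Continuous k := by
    refine Continuous.subtype_mk ((continuous_const.sub ?_).div_const _) _
    exact continuousOn_iff_continuous_domRestrict.1 (hcont.mono hT.subset)
  have hkeq : ∀ p q : T, k p = k q ↔ γ p = γ q := by
    intro p q
    rw [← heq p p.2 q q.2, Subtype.ext_iff]
    change (h 0 - h p) / (h 0 - h 1) = (h 0 - h q) / (h 0 - h 1) ↔ _
    rw [div_left_inj' hpos.ne', sub_right_inj]
  have hsurj : Function.Surjective k := by
    intro c
    obtain ⟨t, ht, htc⟩ : h 0 - c * (h 0 - h 1) ∈ h '' Icc 0 1 := by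
      apply intermediate_value_Icc' zero_le_one hcont
      have h1 := c.2.1
      have h2 := c.2.2
      constructor <;> nlinarith
    have hgoal : ∀ s : T, h s = h t → ∃ s, k s = c := by
      intro s hs
      refine ⟨s, Subtype.ext ?_⟩
      change (h 0 - h s) / (h 0 - h 1) = c
      rw [hs, htc, div_eq_iff hpos.ne']
      ring
    by_cases htT : t ∈ T
    · exact hgoal ⟨t, htT⟩ rfl
    -- A height attained inside a gap is attained at its ends: `h` is monotone and agrees at both.
    · obtain ⟨u, hu, v, hv, hut, htv, -, huv⟩ := hT.gap t ht htT
      have h1 := hanti (hT.subset hu) ht hut.le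
      have h2 := hanti ht (hT.subset hv) htv.le
      have h3 := (heq u hu v hv).2 huv
      exact hgoal ⟨u, hu⟩ (le_antisymm (h3 ▸ h2) h1)
  have hTc : CompactSpace T :=
    isCompact_iff_compactSpace.1 (isCompact_Icc.of_isClosed_subset hT.isClosed hT.subset)
  have hq : IsQuotientMap k := hk.isClosedMap.isQuotientMap hk hsurj
  let e : unitInterval → X := fun c => γ (Function.surjInv hsurj c).1
  have hek : ∀ t : T, e (k t) = γ t := fun t =>
    (hkeq _ _).1 (Function.surjInv_eq hsurj (k t))
  have hec : Continuous e := by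
    rw [hq.continuous_iff]
    have : e ∘ k = fun t : T => γ t := funext hek
    rw [this]
    exact hγ.comp continuous_subtype_val
  have hinj : Function.Injective e := by
    intro c c' hcc
    have := (hkeq _ _).2 hcc
    rwa [Function.surjInv_eq hsurj, Function.surjInv_eq hsurj] at this
  refine ⟨range e, ?_, e, (hec.isClosedEmbedding hinj).isEmbedding, ?_, ?_, rfl⟩
  · rintro _ ⟨c, rfl⟩
    exact ⟨_, hT.subset (Function.surjInv hsurj c).2, rfl⟩
  · have : k ⟨0, hT.zero_mem⟩ = 0 := Subtype.ext (by simp [k])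
    rw [← this, hek]
  · have : k ⟨1, hT.one_mem⟩ = 1 := Subtype.ext (by simp [k, hpos.ne'])
    rw [← this, hek]

end ArcExtraction

theorem JoinedIn.exists_isArcBetween {X : Type*} [TopologicalSpace X] [CompactSpace X]
    [TopologicalSpace.MetrizableSpace X] {S : Set X} {a b : X} (h : JoinedIn S a b) (hab : a ≠ b) :
    ∃ A ⊆ S, IsArcBetween A a b := by
  let _ := TopologicalSpace.metrizableSpaceMetric X
  obtain ⟨γ, hγ⟩ := h
  obtain ⟨A, hA, hA'⟩ := exists_isArcBetween_subset_image (γ := γ.extend) γ.continuous_extend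
    (by simpa using hab)
  refine ⟨A, hA.trans ?_, by simpa using hA'⟩
  rintro _ ⟨t, ht, rfl⟩
  rw [γ.extend_apply ht]
  exact hγ _

/-! ### Branches and cut points -/

section Branches

variable {X : Type*} [TopologicalSpace X]

/-- The component of `{r}ᶜ` containing `a` (empty when `a = r`). -/
def branchAt (r a : X) : Set X := connectedComponentIn {r}ᶜ a

theorem mem_branchAt_self {r a : X} (h : a ≠ r) : a ∈ branchAt r a :=
  mem_connectedComponentIn h

theorem self_notMem_branchAt (r a : X) : r ∉ branchAt r a :=
  fun h => connectedComponentIn_subset _ _ h rfl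

theorem ne_of_mem_branchAt {r a b : X} (h : b ∈ branchAt r a) : b ≠ r := by
  rintro rfl
  exact self_notMem_branchAt _ _ h

@[simp] theorem branchAt_self (r : X) : branchAt r r = ∅ :=
  connectedComponentIn_eq_empty (by simp)

theorem isPreconnected_branchAt (r a : X) : IsPreconnected (branchAt r a) :=
  isPreconnected_connectedComponentIn

theorem branchAt_eq_of_mem {r a b : X} (h : b ∈ branchAt r a) : branchAt r a = branchAt r b :=
  connectedComponentIn_eq h

theorem IsPreconnected.subset_branchAt {s : Set X} (hs : IsPreconnected s) {r a : X} (ha : a ∈ s)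
    (hr : r ∉ s) : s ⊆ branchAt r a :=
  hs.subset_connectedComponentIn ha fun x hx hxr => hr (by rwa [← show x = r from hxr])

theorem IsPreconnected.branchAt_eq {s : Set X} (hs : IsPreconnected s) {r a b : X} (ha : a ∈ s)
    (hb : b ∈ s) (hr : r ∉ s) : branchAt r a = branchAt r b :=
  branchAt_eq_of_mem (hs.subset_branchAt ha hr hb)

theorem eq_of_mem_branchAt {r a b c : X} (ha : c ∈ branchAt r a) (hb : c ∈ branchAt r b) :
    branchAt r a = branchAt r b :=
  (branchAt_eq_of_mem ha).trans (branchAt_eq_of_mem hb).symm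

theorem mem_branchAt_iff {r a b : X} (hb : b ≠ r) :
    b ∈ branchAt r a ↔ branchAt r a = branchAt r b :=
  ⟨branchAt_eq_of_mem, fun h => h ▸ mem_branchAt_self hb⟩

theorem mem_branchAt_comm {r a b : X} : b ∈ branchAt r a ↔ a ∈ branchAt r b := by
  have key : ∀ a b : X, b ∈ branchAt r a → a ∈ branchAt r b := by
    intro a b h
    rw [← branchAt_eq_of_mem h]
    apply mem_branchAt_self
    rintro rfl
    simp at h
  exact ⟨key a b, key b a⟩

theorem left_mem_branchAt {r a b : X} (h : b ∈ branchAt r a) : a ∈ branchAt r a := by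
  rw [branchAt_eq_of_mem h]
  exact mem_branchAt_comm.1 h

/-- The order on `X` rooted at `x`: `s` lies on the way from `x` to `t`. -/
def RootLE (x s t : X) : Prop := t ∉ branchAt s x

theorem RootLE.refl (x s : X) : RootLE x s s := self_notMem_branchAt s x

theorem RootLE.root_le (x s : X) : RootLE x x s := by
  simp [RootLE]

theorem RootLE.branchAt_ne {x m s : X} (h : RootLE x m s) (hms : s ≠ m) :
    branchAt m s ≠ branchAt m x := fun he => h (he ▸ mem_branchAt_self hms)

variable [LocallyConnectedSpace X] [T1Space X]

theorem isOpen_branchAt (r a : X) : IsOpen (branchAt r a) :=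
  isOpen_compl_singleton.connectedComponentIn

theorem closure_branchAt_subset (r a : X) : closure (branchAt r a) ⊆ insert r (branchAt r a) := by
  intro x hx
  by_cases hxr : x = r
  · exact Or.inl hxr
  · obtain ⟨y, hy, hya⟩ := mem_closure_iff.1 hx _ (isOpen_branchAt r x) (mem_branchAt_self hxr)
    rw [eq_of_mem_branchAt hya hy]
    exact Or.inr (mem_branchAt_self hxr)

theorem isClosed_insert_branchAt (r a : X) : IsClosed (insert r (branchAt r a)) := by
  refine isClosed_of_closure_subset ?_
  rw [insert_eq, closure_union, closure_singleton]
  exact union_subset subset_union_left (closure_branchAt_subset r a)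

variable [ConnectedSpace X]

/-- If `r` were not in the closure, the branch would be clopen. -/
theorem isPreconnected_insert_branchAt (r a : X) : IsPreconnected (insert r (branchAt r a)) := by
  rcases eq_or_ne a r with rfl | har
  · simpa using isPreconnected_singleton
  have hr : r ∈ closure (branchAt r a) := by
    by_contra hr
    have hcl : IsClosed (branchAt r a) := by
      refine isClosed_of_closure_subset fun x hx => ?_
      rcases closure_branchAt_subset r a hx with rfl | h
      · exact (hr hx).elim
      · exact h
    have := IsClopen.eq_univ ⟨hcl, isOpen_branchAt r a⟩ ⟨a, mem_branchAt_self har⟩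
    exact self_notMem_branchAt r a (this ▸ mem_univ r)
  exact (isPreconnected_branchAt r a).subset_closure (subset_insert _ _)
    (insert_subset hr subset_closure)

theorem isPreconnected_compl_branchAt (r a : X) : IsPreconnected (branchAt r a)ᶜ := by
  refine isPreconnected_of_forall r fun y hy => ⟨insert r (branchAt r y), ?_, mem_insert _ _, ?_,
    isPreconnected_insert_branchAt r y⟩
  · rintro z (rfl | hz) hz'
    · exact self_notMem_branchAt _ _ hz'
    · apply hy
      rw [eq_of_mem_branchAt hz' hz]
      apply mem_branchAt_self
      rintro rfl
      simp at hz
  · by_cases h : y = r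
    · exact Or.inl h
    · exact Or.inr (mem_branchAt_self h)

theorem insert_branchAt_subset {x s t : X} (ht : t ∉ branchAt s x) (hts : t ≠ s) :
    insert s (branchAt s x) ⊆ branchAt t x := by
  refine (isPreconnected_insert_branchAt s x).subset_branchAt ?_ ?_
  · by_cases h : x = s
    · exact Or.inl h
    · exact Or.inr (mem_branchAt_self h)
  · rintro (h | h)
    · exact hts h
    · exact ht h

theorem RootLE.branchAt_subset {x s t : X} (h : RootLE x s t) : branchAt s x ⊆ branchAt t x := by
  by_cases hts : t = s
  · rw [hts]
  · exact (subset_insert _ _).trans (insert_branchAt_subset h hts)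

theorem RootLE.trans {x s t u : X} (h : RootLE x s t) (h' : RootLE x t u) : RootLE x s u :=
  fun hu => h' (h.branchAt_subset hu)

theorem RootLE.antisymm {x s t : X} (h : RootLE x s t) (h' : RootLE x t s) : s = t := by
  by_contra hst
  exact h' (insert_branchAt_subset h (Ne.symm hst) (mem_insert _ _))

/-- If neither precedes the other, the complement of the branch at `s` towards `x` is connected,
avoids `t` and contains `s` and `u`; so `u` lies in the branch at `t` of `s`, which is that of `x`.
-/
theorem RootLE.total {x s t u : X} (hs : RootLE x s u) (ht : RootLE x t u) :
    RootLE x s t ∨ RootLE x t s := by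
  by_contra! h
  obtain ⟨h1, h2⟩ := h
  simp only [RootLE, not_not] at h1 h2
  have h3 := (isPreconnected_compl_branchAt s x).subset_branchAt (r := t)
    (self_notMem_branchAt s x) (fun h => h h1) hs
  rw [← branchAt_eq_of_mem h2] at h3
  exact ht h3

end Branches

/-! ### Ramification points -/

section Ramification

variable {X : Type*} [TopologicalSpace X]

theorem isRamificationPoint_of_ne {m a b c : X} (ha : a ≠ m) (hb : b ≠ m) (hc : c ≠ m)
    (hab : branchAt m a ≠ branchAt m b) (hac : branchAt m a ≠ branchAt m c)
    (hbc : branchAt m b ≠ branchAt m c) : IsRamificationPoint m := by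
  have h3 : ({branchAt m a, branchAt m b, branchAt m c} : Set (Set X)).encard = 3 :=
    Set.encard_eq_three.2 ⟨_, _, _, hab, hac, hbc, rfl⟩
  rw [IsRamificationPoint, ← h3]
  refine Set.encard_le_encard ?_
  rintro _ (rfl | rfl | rfl)
  · exact ⟨a, ha, rfl⟩
  · exact ⟨b, hb, rfl⟩
  · exact ⟨c, hc, rfl⟩

theorem IsRamificationPoint.exists_branchAt_ne {r : X} (hr : IsRamificationPoint r) (A B : Set X) :
    ∃ z, z ≠ r ∧ branchAt r z ≠ A ∧ branchAt r z ≠ B := by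
  by_contra! hcon
  have hsub : pointComponents r ⊆ {A, B} := by
    rintro _ ⟨z, hz, rfl⟩
    by_cases h : branchAt r z = A
    · exact Or.inl h
    · exact Or.inr (hcon z hz h)
  have h1 : (pointComponents r).encard ≤ 2 :=
    (Set.encard_le_encard hsub).trans <| by
      refine (Set.encard_insert_le _ _).trans ?_
      rw [Set.encard_singleton, one_add_one_eq_two]
  have h2 : (3 : ℕ∞) ≤ 2 := le_trans hr h1
  exact absurd h2 (by decide)

theorem IsRamificationPoint.exists_three {r : X} (hr : IsRamificationPoint r) :
    ∃ a b c, a ≠ r ∧ b ≠ r ∧ c ≠ r ∧ branchAt r a ≠ branchAt r b ∧ branchAt r a ≠ branchAt r c ∧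
      branchAt r b ≠ branchAt r c := by
  obtain ⟨a, ha, -, -⟩ := hr.exists_branchAt_ne ∅ ∅
  obtain ⟨b, hb, hab, -⟩ := hr.exists_branchAt_ne (branchAt r a) ∅
  obtain ⟨c, hc, hac, hbc⟩ := hr.exists_branchAt_ne (branchAt r a) (branchAt r b)
  exact ⟨a, b, c, ha, hb, hc, hab.symm, hac.symm, hbc.symm⟩

variable [LocallyConnectedSpace X] [T1Space X] [ConnectedSpace X]

theorem branchAt_eq_of_ne_of_ne {r r' a b : X} (hrr : r' ≠ r) (ha : a ∉ branchAt r r')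
    (hb : b ∉ branchAt r r') : branchAt r' a = branchAt r' b :=
  (isPreconnected_compl_branchAt r r').branchAt_eq ha hb fun h => h (mem_branchAt_self hrr)

/-- At most one of the three points is in the branch of `r'` at `r`; the other two lie in a
connected set avoiding `r'`. -/
theorem eq_of_separates_three {r r' a b c : X}
    (hab : branchAt r a ≠ branchAt r b) (hac : branchAt r a ≠ branchAt r c)
    (hbc : branchAt r b ≠ branchAt r c) (hab' : branchAt r' a ≠ branchAt r' b)
    (hac' : branchAt r' a ≠ branchAt r' c) (hbc' : branchAt r' b ≠ branchAt r' c) : r = r' := by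
  by_contra hne
  have hne' : r' ≠ r := Ne.symm hne
  have key : ∀ {p q : X}, branchAt r p ≠ branchAt r q → p ∈ branchAt r r' → q ∉ branchAt r r' := by
    intro p q hpq hp hq
    exact hpq ((branchAt_eq_of_mem hp).symm.trans (branchAt_eq_of_mem hq))
  by_cases ha : a ∈ branchAt r r'
  · exact hbc' (branchAt_eq_of_ne_of_ne hne' (key hab ha) (key hac ha))
  by_cases hb : b ∈ branchAt r r'
  · exact hac' (branchAt_eq_of_ne_of_ne hne' ha (key hbc hb))
  · exact hab' (branchAt_eq_of_ne_of_ne hne' ha hb)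

/-- Each ramification point separates three points of a countable dense set, and that triple
determines it. -/
theorem countable_isRamificationPoint [SecondCountableTopology X] :
    {r : X | IsRamificationPoint r}.Countable := by
  have hne : Nonempty X := inferInstance
  obtain ⟨D, hDc, hDd⟩ := TopologicalSpace.exists_countable_dense X
  have hex : ∀ r : {r : X | IsRamificationPoint r}, ∃ a b c : D,
      branchAt r.1 a ≠ branchAt r.1 b ∧ branchAt r.1 a ≠ branchAt r.1 c ∧
        branchAt r.1 b ≠ branchAt r.1 c := by
    rintro ⟨r, hr⟩
    obtain ⟨a, b, c, ha, hb, hc, hab, hac, hbc⟩ := IsRamificationPoint.exists_three hr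
    have key : ∀ p, p ≠ r → ∃ d : D, branchAt r d = branchAt r p := by
      intro p hp
      obtain ⟨d, hd, hdD⟩ := hDd.inter_open_nonempty _ (isOpen_branchAt r p)
        ⟨p, mem_branchAt_self hp⟩
      exact ⟨⟨d, hdD⟩, (branchAt_eq_of_mem hd).symm⟩
    obtain ⟨a', ha'⟩ := key a ha
    obtain ⟨b', hb'⟩ := key b hb
    obtain ⟨c', hc'⟩ := key c hc
    exact ⟨a', b', c', by rwa [ha', hb'], by rwa [ha', hc'], by rwa [hb', hc']⟩
  choose a b c hab hac hbc using hex
  have : Countable D := hDc.to_subtype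
  have hinj : Function.Injective fun r => (a r, b r, c r) := by
    intro r r' h
    simp only [Prod.mk.injEq] at h
    obtain ⟨h1, h2, h3⟩ := h
    refine Subtype.ext (eq_of_separates_three (hab r) (hac r) (hbc r) ?_ ?_ ?_)
    · rw [h1, h2]; exact hab r'
    · rw [h1, h3]; exact hac r'
    · rw [h2, h3]; exact hbc r'
  exact hinj.countable

end Ramification

/-! ### Arcs in dendrites -/

theorem joinedIn_branchAt {X : Type*} [TopologicalSpace X] [CompactSpace X]
    [LocallyConnectedSpace X] [TopologicalSpace.MetrizableSpace X] {r a b : X} (h : b ∈ branchAt r a) : JoinedIn (branchAt r a) a b := by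
  have : LocallyPathConnectedSpace X := locallyPathConnectedSpace_of_compact_metrizable
  have ha : a ∈ branchAt r a := left_mem_branchAt h
  have hc : IsConnected (branchAt r a) := ⟨⟨a, ha⟩, isPreconnected_branchAt r a⟩
  exact ((isOpen_branchAt r a).isConnected_iff_isPathConnected.1 hc).joinedIn a ha b h

namespace IsDendrite

variable {X : Type*} [TopologicalSpace X] [CompactSpace X] [ConnectedSpace X]
  [LocallyConnectedSpace X] [TopologicalSpace.MetrizableSpace X]

omit [ConnectedSpace X] in
-- A branch is open and connected, hence path connected. If it contained both ends it would contain
-- an arc avoiding `r`, against uniqueness of arcs.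
theorem notMem_branchAt_of_mem_arc (hX : IsDendrite X) {A : Set X} {a b r : X}
    (hA : IsArcBetween A a b) (hr : r ∈ A) : b ∉ branchAt r a := by
  intro hb
  have hab : a ≠ b := by
    obtain ⟨γ, hγ, rfl, rfl, -⟩ := hA
    exact fun h => zero_ne_one (hγ.injective h)
  obtain ⟨A', hA', hA'b⟩ := (joinedIn_branchAt hb).exists_isArcBetween hab
  have := (hX.existsUnique_arc a b hab).unique hA hA'b
  exact self_notMem_branchAt r a (hA' (this ▸ hr))

omit [ConnectedSpace X] in
theorem exists_separating (hX : IsDendrite X) {S : Set X} (hS : IsArcwiseDense S) {a b : X}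
    (hab : a ≠ b) : ∃ r ∈ S, r ≠ a ∧ r ≠ b ∧ b ∉ branchAt r a ∧ r ∈ branchAt a b ∧
      r ∈ branchAt b a := by
  obtain ⟨A, ⟨γ, hγ, h0, h1, hA⟩, -⟩ := hX.existsUnique_arc a b hab
  -- Reparametrising to the middle third keeps the chosen point off both ends of the arc.
  let φ : unitInterval → unitInterval := fun t =>
    ⟨1 / 3 + t / 3, by have := t.2.1; linarith, by have := t.2.2; linarith⟩
  have hφc : Continuous φ := by
    refine Continuous.subtype_mk ?_ _
    fun_prop
  have hφi : Function.Injective φ := by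
    intro s t hst
    have h : (1 / 3 + s / 3 : ℝ) = 1 / 3 + t / 3 := Subtype.ext_iff.1 hst
    exact Subtype.ext (by linarith)
  obtain ⟨r, hrS, t, ht⟩ := hS _ _ _ ⟨γ ∘ φ, hγ.comp (hφc.isClosedEmbedding hφi).isEmbedding,
    rfl, rfl, rfl⟩
  have hpos : 0 < φ t := by
    rw [← Subtype.coe_lt_coe]
    change (0 : ℝ) < 1 / 3 + t / 3
    have := t.2.1
    linarith
  have hlt : φ t < 1 := by
    rw [← Subtype.coe_lt_coe]
    change (1 / 3 + t / 3 : ℝ) < 1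
    have := t.2.2
    linarith
  change γ (φ t) = r at ht
  subst ht
  refine ⟨_, hrS, ?_, ?_, hX.notMem_branchAt_of_mem_arc ⟨γ, hγ, h0, h1, rfl⟩ ⟨_, rfl⟩, ?_, ?_⟩
  · rw [← h0]
    exact fun h => hpos.ne' (hγ.injective h)
  · rw [← h1]
    exact fun h => hlt.ne (hγ.injective h)
  · refine (isPreconnected_Ioi.image γ hγ.continuous.continuousOn).subset_branchAt
      (s := γ '' Ioi 0) ⟨1, mem_Ioi.2 zero_lt_one, h1⟩ ?_ ⟨_, hpos, rfl⟩
    rintro ⟨s, hs, hsa⟩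
    rw [← h0] at hsa
    exact (ne_of_gt hs) (hγ.injective hsa)
  · refine (isPreconnected_Iio.image γ hγ.continuous.continuousOn).subset_branchAt
      (s := γ '' Iio 1) ⟨0, mem_Iio.2 zero_lt_one, h0⟩ ?_ ⟨_, hlt, rfl⟩
    rintro ⟨s, hs, hsa⟩
    rw [← h1] at hsa
    exact (ne_of_lt hs) (hγ.injective hsa)

theorem exists_mem_of_isOpen (hX : IsDendrite X) [Nontrivial X] {S : Set X}
    (hS : IsArcwiseDense S) {O : Set X} (hO : IsOpen O) (hne : O.Nonempty) : (S ∩ O).Nonempty := by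
  obtain ⟨k, hk⟩ := hne
  have hop := hO.connectedComponentIn (x := k)
  have hkk := mem_connectedComponentIn hk
  obtain ⟨l, hl, hlk⟩ : ∃ l ∈ connectedComponentIn O k, l ≠ k := by
    by_contra! h
    have h1 : connectedComponentIn O k = {k} :=
      Subset.antisymm (fun l hl => h l hl) (singleton_subset_iff.2 hkk)
    have h2 := IsClopen.eq_univ ⟨isClosed_singleton (x := k), h1 ▸ hop⟩ ⟨k, rfl⟩
    obtain ⟨z, hz⟩ := exists_ne k
    exact hz (h2 ▸ mem_univ z : z ∈ ({k} : Set X))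
  obtain ⟨r, hrS, -, -, hr, -⟩ := hX.exists_separating hS hlk
  refine ⟨r, hrS, connectedComponentIn_subset O k ?_⟩
  by_contra hrK
  exact hr (isPreconnected_connectedComponentIn.subset_branchAt hl hrK hkk)

omit [ConnectedSpace X] in
theorem rootLE_iff_mem_arc (hX : IsDendrite X) {A : Set X} {x s r : X}
    (hA : IsArcBetween A x s) : RootLE x r s ↔ r ∈ A := by
  constructor
  · intro h
    by_contra hr
    obtain ⟨γ, hγ, h0, h1, rfl⟩ := hA
    exact h ((isPreconnected_range hγ.continuous).subset_branchAt ⟨0, h0⟩ hr ⟨1, h1⟩)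
  · exact fun h => hX.notMem_branchAt_of_mem_arc hA h

theorem isClosed_setOf_rootLE (hX : IsDendrite X) (x t : X) : IsClosed {r | RootLE x r t} := by
  rcases eq_or_ne x t with rfl | hxt
  · have : {r | RootLE x r x} = {x} := by
      ext r
      constructor
      · intro h
        by_contra hr
        exact h (mem_branchAt_self (Ne.symm hr))
      · rintro rfl
        exact RootLE.refl _ _
    rw [this]
    exact isClosed_singleton
  · obtain ⟨A, hA, -⟩ := hX.existsUnique_arc x t hxt
    have : {r | RootLE x r t} = A := by
      ext r
      exact hX.rootLE_iff_mem_arc hA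
    rw [this]
    obtain ⟨γ, hγ, -, -, rfl⟩ := hA
    exact (isCompact_range hγ.continuous).isClosed

/-- The meet is the last point of the arc from `x` to `s` that precedes `t`. If `s` and `t` shared a
branch there, a path joining them inside it would pass through every later point of the arc, hence
by closedness through the meet itself. -/
theorem exists_rootMeet (hX : IsDendrite X) (x s t : X) : ∃ m, RootLE x m s ∧ RootLE x m t ∧
    (∀ r, RootLE x r s → RootLE x r t → RootLE x r m) ∧
      (m = s ∨ m = t ∨ branchAt m s ≠ branchAt m t) := by
  rcases eq_or_ne x s with rfl | hxs
  · exact ⟨x, RootLE.refl x x, RootLE.root_le x t, fun r h _ => h, Or.inl rfl⟩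
  obtain ⟨A, hA, -⟩ := hX.existsUnique_arc x s hxs
  have hAs := fun r => hX.rootLE_iff_mem_arc (r := r) hA
  obtain ⟨γ, hγ, h0, h1, rfl⟩ := hA
  have hmono : ∀ u v, u ≤ v → RootLE x (γ u) (γ v) := by
    intro u v huv
    rcases huv.eq_or_lt with rfl | huv
    · exact RootLE.refl _ _
    intro hv
    have hpre := isPreconnected_Ici.image γ (hγ.continuous.continuousOn (s := Ici v))
    have hnot : γ u ∉ γ '' Ici v := by
      rintro ⟨w, hw, hwu⟩
      rw [hγ.injective hwu] at hw
      exact not_lt_of_ge hw huv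
    have := hpre.subset_branchAt (mem_image_of_mem γ self_mem_Ici) hnot
      ⟨1, mem_Ici.2 unitInterval.le_one', h1⟩
    rw [← branchAt_eq_of_mem hv] at this
    exact (hAs (γ u)).2 ⟨u, rfl⟩ this
  have hcl : IsClosed (γ ⁻¹' {r | RootLE x r t}) :=
    (hX.isClosed_setOf_rootLE x t).preimage hγ.continuous
  obtain ⟨u₀, hu₀, hmax⟩ := hcl.isCompact.exists_isGreatest
    ⟨0, by change RootLE x (γ 0) t; rw [h0]; exact RootLE.root_le x t⟩
  refine ⟨γ u₀, (hAs _).2 ⟨u₀, rfl⟩, hu₀, ?_, ?_⟩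
  · intro r hrs hrt
    obtain ⟨u, rfl⟩ := (hAs r).1 hrs
    exact hmono _ _ (hmax hrt)
  by_cases hms : γ u₀ = s
  · exact Or.inl hms
  by_cases hmt : γ u₀ = t
  · exact Or.inr (Or.inl hmt)
  refine Or.inr (Or.inr fun heq => ?_)
  have htK : t ∈ branchAt (γ u₀) s := heq ▸ mem_branchAt_self (Ne.symm hmt)
  obtain ⟨p, hp⟩ := joinedIn_branchAt htK
  have hsub : Ioi u₀ ⊆ γ ⁻¹' range p := by
    intro u hu
    by_contra hup
    have hut : ¬ RootLE x (γ u) t := fun h => not_lt_of_ge (hmax h) hu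
    rw [RootLE, not_not] at hut
    have h2 := (isPreconnected_range p.continuous).subset_branchAt (a := t) (r := γ u)
      ⟨1, p.target⟩ hup ⟨0, p.source⟩
    rw [← branchAt_eq_of_mem hut] at h2
    exact (hAs (γ u)).2 ⟨u, rfl⟩ h2
  have hcl' : IsClosed (γ ⁻¹' range p) :=
    (isCompact_range p.continuous).isClosed.preimage hγ.continuous
  have hu₀1 : u₀ < 1 := lt_of_le_of_ne le_top (by rintro rfl; exact hms h1)
  have hmem : u₀ ∈ closure (Ioi u₀) := by
    rw [closure_Ioi' (a := u₀) ⟨1, hu₀1⟩]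
    exact self_mem_Ici
  obtain ⟨w, hw⟩ := closure_minimal hsub hcl' hmem
  exact self_notMem_branchAt (γ u₀) s (hw ▸ hp w)

end IsDendrite

/-! ### End points -/

/-- A point which is separated from every finite set of other points by a ramification point. -/
def IsEndLike {X : Type*} [TopologicalSpace X] (y : X) : Prop :=
  ∀ F : Set X, F.Finite → y ∉ F →
    ∃ r, IsRamificationPoint r ∧ r ≠ y ∧ ∃ c, F ⊆ branchAt r c ∧ y ∉ branchAt r c

theorem IsEndLike.exists_rootLE {X : Type*} [TopologicalSpace X] {x : X} (hx : IsEndLike x)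
    {F : Set X} (hF : F.Finite) (hxF : x ∉ F) :
    ∃ r, IsRamificationPoint r ∧ r ≠ x ∧ ∀ z ∈ F, RootLE x r z := by
  obtain ⟨r, hr, hrx, c, hFc, hxc⟩ := hx F hF hxF
  refine ⟨r, hr, hrx, fun z hz hzx => hxc ?_⟩
  rw [eq_of_mem_branchAt (hFc hz) hzx]
  exact mem_branchAt_self hrx.symm

section EndLike

variable {X : Type*} [TopologicalSpace X] [LocallyConnectedSpace X] [T1Space X] [ConnectedSpace X]

theorem IsEndLike.branchAt_eq {x a b : X} (hx : IsEndLike x) (ha : a ≠ x) (hb : b ≠ x) :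
    branchAt x a = branchAt x b := by
  obtain ⟨r, -, hrx, hr⟩ := hx.exists_rootLE (F := {a, b}) (by simp)
    (by simp [ha.symm, hb.symm])
  exact (isPreconnected_compl_branchAt r x).branchAt_eq (hr a (by simp)) (hr b (by simp))
    fun h => h (mem_branchAt_self hrx.symm)

theorem IsEndLike.not_isRamificationPoint {x : X} (hx : IsEndLike x) :
    ¬ IsRamificationPoint x := by
  intro h
  obtain ⟨a, b, -, ha, hb, -, hab, -⟩ := h.exists_three
  exact hab (hx.branchAt_eq ha hb)

/-- Finitely many branches missing `x` cover the complement of `V`. A point `s` separating `x` from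
all their base points has every one of these branches beyond it. -/
theorem IsEndLike.exists_branchAt_subset [CompactSpace X] {x : X} (hx : IsEndLike x) {V : Set X}
    (hV : IsOpen V) (hxV : x ∈ V) :
    ∃ r, IsRamificationPoint r ∧ r ≠ x ∧ branchAt r x ⊆ V := by
  have hex : ∀ z : X, ∃ r c : X, z ≠ x → r ≠ x ∧ z ∈ branchAt r c ∧ x ∉ branchAt r c := by
    intro z
    by_cases hz : z = x
    · exact ⟨x, x, fun h => (h hz).elim⟩
    · obtain ⟨r, -, hrx, c, hzc, hxc⟩ := hx {z} (by simp) (by simpa using Ne.symm hz)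
      exact ⟨r, c, fun _ => ⟨hrx, hzc rfl, hxc⟩⟩
  choose r c h using hex
  have hne : ∀ z ∈ Vᶜ, z ≠ x := by
    rintro z hz rfl
    exact hz hxV
  obtain ⟨t, ht, htc⟩ := hV.isClosed_compl.isCompact.elim_nhds_subcover
    (fun z => branchAt (r z) (c z)) fun z hz =>
      (isOpen_branchAt _ _).mem_nhds (h z (hne z hz)).2.1
  obtain ⟨s, hs, hsx, hsr⟩ := hx.exists_rootLE (F := r '' t) (t.finite_toSet.image _) (by
    rintro ⟨z, hz, hzx⟩
    exact (h z (hne z (ht z hz))).1 hzx)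
  refine ⟨s, hs, hsx, fun w hw => ?_⟩
  by_contra hwV
  obtain ⟨z, hz, hwz⟩ := mem_iUnion₂.1 (htc hwV)
  obtain ⟨h1, -, h2⟩ := h z (hne z (ht z hz))
  refine (hsr (r z) ⟨z, hz, rfl⟩).trans (t := r z) (u := w) ?_ hw
  intro hwx
  apply h2
  rw [eq_of_mem_branchAt hwz hwx]
  exact mem_branchAt_self h1.symm

end EndLike

namespace IsDendrite

variable {X : Type*} [TopologicalSpace X] [CompactSpace X] [ConnectedSpace X]
  [LocallyConnectedSpace X] [TopologicalSpace.MetrizableSpace X]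

/-- One step of the nested construction: `r'` has at least three branches, so one of them contains
neither `r` nor `ρ`. -/
theorem exists_smaller_branchAt (hX : IsDendrite X)
    (hR : IsArcwiseDense {r : X | IsRamificationPoint r}) {r c : X} (hcr : c ≠ r) (ρ : X) :
    ∃ r' c', IsRamificationPoint r' ∧ r' ∈ branchAt r c ∧ r' ≠ ρ ∧ c' ≠ r' ∧
      r ∉ branchAt r' c' ∧ ρ ∉ branchAt r' c' := by
  obtain ⟨r', hr', hrc, hρ⟩ : ∃ r', IsRamificationPoint r' ∧ r' ∈ branchAt r c ∧ r' ≠ ρ := by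
    obtain ⟨r₁, h1, h1r, -, -, h1c, -⟩ := hX.exists_separating hR hcr.symm
    by_cases hρ : r₁ = ρ
    · obtain ⟨r₂, h2, -, h2r, -, h2c, -⟩ := hX.exists_separating hR h1r.symm
      exact ⟨r₂, h2, by rwa [branchAt_eq_of_mem h1c], hρ ▸ h2r⟩
    · exact ⟨r₁, h1, h1c, hρ⟩
  obtain ⟨c', hc', h1, h2⟩ := hr'.exists_branchAt_ne (branchAt r' r) (branchAt r' ρ)
  exact ⟨r', c', hr', hrc, hρ, hc', fun h => h1 (branchAt_eq_of_mem h),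
    fun h => h2 (branchAt_eq_of_mem h)⟩

theorem countable_isRamificationPoint (_hX : IsDendrite X) :
    {r : X | IsRamificationPoint r}.Countable := by
  let _ := TopologicalSpace.metrizableSpaceMetric X
  exact _root_.countable_isRamificationPoint

/-- Nested branches are chosen to avoid, one by one, the points of `S` and all ramification points.
A point `y` of the intersection is then outside `S`. Any `z ≠ y` is separated from `y` by some `ρ
n`, so the connected set `L (n + 1)`, which contains `y` but not `ρ n`, misses `z`. -/
theorem exists_isEndLike (hX : IsDendrite X) [Nontrivial X]
    (hR : IsArcwiseDense {r : X | IsRamificationPoint r}) {S : Set X} (hS : S.Countable) :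
    ∃ y ∉ S, IsEndLike y := by
  obtain ⟨r₀, hr₀, -⟩ := hX.exists_mem_of_isOpen hR isOpen_univ univ_nonempty
  obtain ⟨c₀, hc₀⟩ := exists_ne r₀
  obtain ⟨ρ, hρ⟩ := (hS.union hX.countable_isRamificationPoint).exists_eq_range ⟨r₀, Or.inr hr₀⟩
  let Q := {p : X × X // p.2 ≠ p.1 ∧ IsRamificationPoint p.1}
  have hstep : ∀ (n : ℕ) (p : Q), ∃ p' : Q, p'.1.1 ∈ branchAt p.1.1 p.1.2 ∧ p'.1.1 ≠ ρ n ∧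
      p.1.1 ∉ branchAt p'.1.1 p'.1.2 ∧ ρ n ∉ branchAt p'.1.1 p'.1.2 := by
    rintro n ⟨⟨r, c⟩, hcr, hr⟩
    obtain ⟨r', c', h1, h2, h3, h4, h5, h6⟩ := hX.exists_smaller_branchAt hR hcr (ρ n)
    exact ⟨⟨(r', c'), h4, h1⟩, h2, h3, h5, h6⟩
  choose G hG1 hG2 hG3 hG4 using hstep
  let p : ℕ → Q := fun n => Nat.rec ⟨(r₀, c₀), hc₀, hr₀⟩ G n
  let r : ℕ → X := fun n => (p n).1.1
  let K : ℕ → Set X := fun n => branchAt (p n).1.1 (p n).1.2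
  let L : ℕ → Set X := fun n => insert (r n) (K n)
  have h1 : ∀ n, r (n + 1) ∈ K n := fun n => hG1 n (p n)
  have h2 : ∀ n, r (n + 1) ≠ ρ n := fun n => hG2 n (p n)
  have h3 : ∀ n, r n ∉ K (n + 1) := fun n => hG3 n (p n)
  have h4 : ∀ n, ρ n ∉ K (n + 1) := fun n => hG4 n (p n)
  have hrn : ∀ n, r n ∉ K n := fun n => self_notMem_branchAt _ _
  have hne : ∀ n, r n ≠ r (n + 1) := fun n he => hrn n (he ▸ h1 n)
  have hLK : ∀ n, L (n + 1) ⊆ K n := by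
    intro n
    have := (isPreconnected_insert_branchAt (r (n + 1)) (p (n + 1)).1.2).subset_branchAt
      (r := r n) (mem_insert _ _) (by
        rintro (h | h)
        · exact hne n h
        · exact h3 n h)
    rwa [← branchAt_eq_of_mem (h1 n)] at this
  have hLL : ∀ n, L (n + 1) ⊆ L n := fun n => (hLK n).trans (subset_insert _ _)
  obtain ⟨y, hy⟩ := IsCompact.nonempty_iInter_of_sequence_nonempty_isCompact_isClosed L hLL
    (fun n => ⟨_, mem_insert _ _⟩) (isClosed_insert_branchAt _ _).isCompact
    (fun n => isClosed_insert_branchAt _ _)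
  rw [mem_iInter] at hy
  have hyK : ∀ n, y ∈ K n := fun n => hLK n (hy (n + 1))
  have hρL : ∀ n, ρ n ∉ L (n + 1) := by
    rintro n (h | h)
    · exact h2 n h.symm
    · exact h4 n h
  have hsep : ∀ z, z ≠ y → ∃ n, z ∉ L n := by
    intro z hz
    obtain ⟨s, hs, -, -, hsy, -⟩ := hX.exists_separating hR hz
    obtain ⟨n, rfl⟩ : s ∈ range ρ := hρ ▸ Or.inr hs
    refine ⟨n + 1, fun hzL => hsy ?_⟩
    exact (isPreconnected_insert_branchAt (r (n + 1)) (p (n + 1)).1.2).subset_branchAt hzL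
      (hρL n) (hy (n + 1))
  refine ⟨y, fun hyS => ?_, fun F hF hyF => ?_⟩
  · obtain ⟨n, hn⟩ : y ∈ range ρ := hρ ▸ Or.inl hyS
    exact hρL n (hn ▸ hy (n + 1))
  · have hsep' : ∀ z, ∃ n, z ≠ y → z ∉ L n := by
      intro z
      by_cases hz : z = y
      · exact ⟨0, fun h => (h hz).elim⟩
      · obtain ⟨n, hn⟩ := hsep z hz
        exact ⟨n, fun _ => hn⟩
    choose N hN using hsep'
    obtain ⟨M, hM⟩ := (hF.image N).bddAbove
    have hanti : Antitone L := antitone_nat_of_succ_le hLL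
    have hFK : F ⊆ (K M)ᶜ := fun z hz hzK =>
      hN z (by rintro rfl; exact hyF hz) (hanti (hM ⟨z, hz, rfl⟩) (Or.inr hzK))
    -- The next base point is used because the complement of `K M` is connected, contains `r M` and
    -- `F`, and avoids `r (M + 1)`; so it lies in a single branch there.
    refine ⟨r (M + 1), (p (M + 1)).2.2, fun h => ?_, r M, ?_, fun hyr => h3 M ?_⟩
    · exact hrn (M + 1) (h ▸ hyK (M + 1))
    · intro z hz
      exact (isPreconnected_compl_branchAt (r M) (p M).1.2).subset_branchAt (hrn M)
        (fun h => h (h1 M)) (hFK hz)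
    · have : K (M + 1) = branchAt (r (M + 1)) (r M) := eq_of_mem_branchAt (hyK (M + 1)) hyr
      rw [this]
      exact mem_branchAt_self (hne M)

/-! ### The tree of ramification points -/

theorem exists_rootLE_between (hX : IsDendrite X) {S : Set X} (hS : IsArcwiseDense S) {x a b : X}
    (hab : RootLE x a b) (hne : a ≠ b) :
    ∃ r ∈ S, r ≠ a ∧ r ≠ b ∧ RootLE x a r ∧ RootLE x r b := by
  obtain ⟨r, hrS, hra, hrb, h1, h2, -⟩ := hX.exists_separating hS hne
  have har : RootLE x a r := by
    intro h
    apply hab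
    rw [eq_of_mem_branchAt h h2]
    exact mem_branchAt_self hne.symm
  refine ⟨r, hrS, hra, hrb, har, fun h => h1 ?_⟩
  rwa [← branchAt_eq_of_mem (insert_branchAt_subset har hra (mem_insert _ _))]

/-- A meet distinct from `s` and `t` has `s`, `t` and `x` in three different branches; it is not
`x`, since an end-like point separates nothing. -/
theorem exists_ramification_meet (hX : IsDendrite X) {x : X} (hx : IsEndLike x) {s t : X}
    (hs : IsRamificationPoint s) (ht : IsRamificationPoint t) :
    ∃ m, IsRamificationPoint m ∧ RootLE x m s ∧ RootLE x m t ∧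
      (∀ r, RootLE x r s → RootLE x r t → RootLE x r m) ∧
        (m = s ∨ m = t ∨ branchAt m s ≠ branchAt m t) := by
  obtain ⟨m, h1, h2, h3, h4⟩ := hX.exists_rootMeet x s t
  refine ⟨m, ?_, h1, h2, h3, h4⟩
  by_cases hms : m = s
  · exact hms ▸ hs
  by_cases hmt : m = t
  · exact hmt ▸ ht
  have hst := (h4.resolve_left hms).resolve_left hmt
  have hsx : s ≠ x := fun h => hx.not_isRamificationPoint (h ▸ hs)
  have htx : t ≠ x := fun h => hx.not_isRamificationPoint (h ▸ ht)
  have hmx : x ≠ m := by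
    rintro rfl
    exact hst (hx.branchAt_eq hsx htx)
  exact isRamificationPoint_of_ne (Ne.symm hms) (Ne.symm hmt) hmx hst
    (h1.branchAt_ne (Ne.symm hms)) (h2.branchAt_ne (Ne.symm hmt))

/-- This expresses sharing a branch through the rooted order alone, so that order automorphisms
preserve branches. -/
theorem branchAt_eq_iff (hX : IsDendrite X) {x : X} (hx : IsEndLike x) {s r w : X}
    (hr : IsRamificationPoint r) (hw : IsRamificationPoint w) (hrs : r ≠ s) (hws : w ≠ s) :
    branchAt s r = branchAt s w ↔
      (∃ m, IsRamificationPoint m ∧ m ≠ s ∧ RootLE x s m ∧ RootLE x m r ∧ RootLE x m w) ∨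
        (¬ RootLE x s r ∧ ¬ RootLE x s w) := by
  constructor
  · intro h
    by_cases hsr : RootLE x s r
    · have hsw : RootLE x s w := by
        intro hwx
        apply hsr
        rw [branchAt_eq_of_mem hwx, ← h]
        exact mem_branchAt_self hrs
      obtain ⟨m, hm, h1, h2, h3, h4⟩ := hX.exists_ramification_meet hx hr hw
      refine Or.inl ⟨m, hm, ?_, h3 s hsr hsw, h1, h2⟩
      rintro rfl
      rcases h4 with h4 | h4 | h4
      · exact hrs h4.symm
      · exact hws h4.symm
      · exact h4 h
    · refine Or.inr ⟨hsr, fun hsw => hsw ?_⟩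
      rw [branchAt_eq_of_mem (not_not.1 hsr), h]
      exact mem_branchAt_self hws
  · rintro (⟨m, -, hms, hsm, hmr, hmw⟩ | ⟨h1, h2⟩)
    · refine (isPreconnected_compl_branchAt m x).branchAt_eq hmr hmw fun h => h ?_
      by_contra hs
      exact hms (RootLE.antisymm hs hsm)
    · simp only [RootLE, not_not] at h1 h2
      rw [← branchAt_eq_of_mem h1, branchAt_eq_of_mem h2]

/-- The meet-semilattice of ramification points of a dendrite rooted at an end point. -/
@[reducible] noncomputable def ramificationTree (hX : IsDendrite X) {x : X} (hx : IsEndLike x) :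
    SemilatticeInf {r : X // IsRamificationPoint r} where
  le r s := RootLE x r.1 s.1
  le_refl r := RootLE.refl x r.1
  le_trans _ _ _ h h' := h.trans h'
  le_antisymm _ _ h h' := Subtype.ext (h.antisymm h')
  inf s t := ⟨(hX.exists_ramification_meet hx s.2 t.2).choose,
    (hX.exists_ramification_meet hx s.2 t.2).choose_spec.1⟩
  inf_le_left s t := (hX.exists_ramification_meet hx s.2 t.2).choose_spec.2.1
  inf_le_right s t := (hX.exists_ramification_meet hx s.2 t.2).choose_spec.2.2.1
  le_inf r s t := (hX.exists_ramification_meet hx s.2 t.2).choose_spec.2.2.2.1 r.1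

/-- Cones at `m` are the traces of the branches at `m` other than the one towards the root, which
accounts for the added one. Density of ramification points makes distinct branches leave distinct
nonempty traces. -/
theorem encard_treeCones_add_one (hX : IsDendrite X) [Nontrivial X] {x : X} (hx : IsEndLike x)
    (hR : IsArcwiseDense {r : X | IsRamificationPoint r})
    (m : {r : X // IsRamificationPoint r}) :
    (@treeCones _ (hX.ramificationTree hx) m).encard + 1 = pointOrder m.1 := by
  let _ := hX.ramificationTree hx
  have hxm : x ≠ m.1 := fun h => hx.not_isRamificationPoint (h ▸ m.2)
  have hlt : ∀ r s : {r : X // IsRamificationPoint r}, r < s ↔ RootLE x r.1 s.1 ∧ s.1 ≠ r.1 := by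
    intro r s
    rw [lt_iff_le_and_ne]
    refine and_congr Iff.rfl ?_
    rw [ne_comm, Ne, Subtype.ext_iff]
  have hcone : ∀ z : {r : X // IsRamificationPoint r}, m < z →
      treeCone m z = Subtype.val ⁻¹' branchAt m.1 z.1 := by
    intro z hz
    obtain ⟨hmz, hzm⟩ := (hlt m z).1 hz
    ext w
    constructor
    · intro hw
      have hw' : m < z ⊓ w := hw
      have hmw : w.1 ≠ m.1 := ((hlt m w).1 (hw'.trans_le inf_le_right)).2
      have heq : branchAt m.1 z.1 = branchAt m.1 w.1 :=
        (hX.branchAt_eq_iff hx z.2 w.2 hzm hmw).2 (Or.inl ⟨(z ⊓ w).1, (z ⊓ w).2,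
          ((hlt _ _).1 hw').2, ((hlt _ _).1 hw').1,
          (inf_le_left : z ⊓ w ≤ z), (inf_le_right : z ⊓ w ≤ w)⟩)
      exact (mem_branchAt_iff hmw).2 heq
    · intro hw
      have hmw : w.1 ≠ m.1 := ne_of_mem_branchAt hw
      rcases (hX.branchAt_eq_iff hx z.2 w.2 hzm hmw).1 (branchAt_eq_of_mem hw) with
        ⟨n, hn, h1, h2, h3, h4⟩ | ⟨h1, -⟩
      · have e1 : m < ⟨n, hn⟩ := (hlt _ _).2 ⟨h2, h1⟩
        have e2 : (⟨n, hn⟩ : {r : X // IsRamificationPoint r}) ≤ z ⊓ w := le_inf h3 h4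
        exact e1.trans_le e2
      · exact absurd hmz h1
  have hdense : ∀ C ∈ pointComponents m.1, ∃ z : {r : X // IsRamificationPoint r},
      z.1 ≠ m.1 ∧ C = branchAt m.1 z.1 := by
    rintro _ ⟨y, hy, rfl⟩
    obtain ⟨z, hz, hzC⟩ := hX.exists_mem_of_isOpen hR (isOpen_branchAt m.1 y)
      ⟨y, mem_branchAt_self hy⟩
    exact ⟨⟨z, hz⟩, ne_of_mem_branchAt hzC, branchAt_eq_of_mem hzC⟩
  have himage : treeCones m = (fun C => Subtype.val ⁻¹' C) ''
      (pointComponents m.1 \ {branchAt m.1 x}) := by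
    ext D
    constructor
    · rintro ⟨z, hz, rfl⟩
      obtain ⟨hmz, hzm⟩ := (hlt m z).1 hz
      exact ⟨branchAt m.1 z.1, ⟨⟨z.1, hzm, rfl⟩, hmz.branchAt_ne hzm⟩, (hcone z hz).symm⟩
    · rintro ⟨C, ⟨hC, hCx⟩, rfl⟩
      obtain ⟨z, hzm, rfl⟩ := hdense C hC
      have hz : m < z := (hlt m z).2 ⟨fun h => hCx (branchAt_eq_of_mem h).symm, hzm⟩
      exact ⟨z, hz, (hcone z hz).symm⟩
  have hinj : InjOn (fun C => (Subtype.val ⁻¹' C : Set {r : X // IsRamificationPoint r}))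
      (pointComponents m.1 \ {branchAt m.1 x}) := by
    rintro C ⟨hC, -⟩ D ⟨hD, -⟩ hCD
    obtain ⟨z, hzm, rfl⟩ := hdense C hC
    obtain ⟨w, -, rfl⟩ := hdense D hD
    have : z.1 ∈ branchAt m.1 w.1 := (Set.ext_iff.1 hCD z).1 (mem_branchAt_self hzm)
    exact (branchAt_eq_of_mem this).symm
  have hmem : branchAt m.1 x ∈ pointComponents m.1 := ⟨x, hxm, rfl⟩
  rw [himage, hinj.encard_image, Set.encard_sdiff_singleton_add_one hmem]
  rfl

theorem isRichTree (hX : IsDendrite X) [Nontrivial X] {x : X} (hx : IsEndLike x)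
    (hR : IsArcwiseDense {r : X | IsRamificationPoint r})
    (hc : ∀ c : X, IsRamificationPoint c →
      IsArcwiseDense {r : X | IsRamificationPoint r ∧ pointOrder r = pointOrder c}) :
    @IsRichTree _ (hX.ramificationTree hx) _
      (fun r : {r : X // IsRamificationPoint r} => pointOrder r.1) := by
  let _ := hX.ramificationTree hx
  have hlt : ∀ r s : {r : X // IsRamificationPoint r}, RootLE x r.1 s.1 → r.1 ≠ s.1 → r < s :=
    fun r s h1 h2 => lt_of_le_of_ne h1 fun h => h2 (congrArg _ h)
  refine ⟨fun a b c h h' => RootLE.total h h', fun b c => ?_, fun a b c hab => ?_,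
    fun a b hab => ?_⟩
  · obtain ⟨r, ⟨hr, hrc⟩, -, hrb, -, h⟩ := hX.exists_rootLE_between (hc c.1 c.2)
      (RootLE.root_le x b.1) (fun h => hx.not_isRamificationPoint (h ▸ b.2))
    exact ⟨⟨r, hr⟩, hlt _ _ h hrb, hrc⟩
  · obtain ⟨r, ⟨hr, hrc⟩, hra, hrb, h1, h2⟩ := hX.exists_rootLE_between (hc c.1 c.2)
      (show RootLE x a.1 b.1 from hab.le) (fun h => hab.ne (Subtype.ext h))
    exact ⟨⟨r, hr⟩, hlt _ _ h1 hra.symm, hlt _ _ h2 hrb, hrc⟩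
  · have h1 := hX.encard_treeCones_add_one hx hR a
    have h2 := hX.encard_treeCones_add_one hx hR b
    have h3 : (treeCones a).encard + 1 = (treeCones b).encard + 1 := by
      rw [h1, h2]
      exact hab
    -- Only the finite summand `1` is cancelled, so infinite order is covered too.
    exact (ENat.add_left_injective_of_ne_top (by simp)) h3

end IsDendrite

/-! ### Extending isomorphisms of the ramification points to homeomorphisms -/

section Extension

/-- `(x, y)` lies in the closure of the graph of the partial map `σ` defined on `{r // p r}`. -/
def ClosureGraph {X : Type*} [TopologicalSpace X] {p : X → Prop}
    (σ : {r : X // p r} ≃ {r : X // p r}) (x y : X) : Prop :=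
  ∀ U V : Set X, IsOpen U → IsOpen V → x ∈ U → y ∈ V → ∃ r, r.1 ∈ U ∧ (σ r).1 ∈ V

/-- `σ` respects the relation of lying in the same branch. -/
def PreservesBranches {X : Type*} [TopologicalSpace X] {p : X → Prop}
    (σ : {r : X // p r} ≃ {r : X // p r}) : Prop :=
  ∀ s r w : {r : X // p r}, r ≠ s → w ≠ s →
    (branchAt s.1 r.1 = branchAt s.1 w.1 ↔ branchAt (σ s).1 (σ r).1 = branchAt (σ s).1 (σ w).1)

variable {X : Type*} [TopologicalSpace X] {p : X → Prop} {σ : {r : X // p r} ≃ {r : X // p r}}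

theorem ClosureGraph.symm {x y : X} (h : ClosureGraph σ x y) : ClosureGraph σ.symm y x := by
  intro U V hU hV hy hx
  obtain ⟨r, hr, hr'⟩ := h V U hV hU hx hy
  exact ⟨σ r, hr', by simpa using hr⟩

theorem PreservesBranches.symm (h : PreservesBranches σ) : PreservesBranches σ.symm := by
  intro s r w hr hw
  have := h (σ.symm s) (σ.symm r) (σ.symm w) (σ.symm.injective.ne hr) (σ.symm.injective.ne hw)
  simpa using this.symm

theorem closureGraph_iff {x y : X} : ClosureGraph σ x y ↔
    (x, y) ∈ closure (range fun r : {r : X // p r} => (r.1, (σ r).1)) := by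
  rw [mem_closure_iff]
  constructor
  · intro h O hO hxy
    obtain ⟨U, V, hU, hV, hx, hy, hUV⟩ := isOpen_prod_iff.1 hO x y hxy
    obtain ⟨r, h1, h2⟩ := h U V hU hV hx hy
    exact ⟨_, hUV ⟨h1, h2⟩, r, rfl⟩
  · intro h U V hU hV hx hy
    obtain ⟨_, h1, r, rfl⟩ := h (U ×ˢ V) (hU.prod hV) ⟨hx, hy⟩
    exact ⟨r, h1.1, h1.2⟩

theorem closureGraph_apply (r : {r : X // p r}) : ClosureGraph σ r.1 (σ r).1 :=
  fun _ _ _ _ h1 h2 => ⟨r, h1, h2⟩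

theorem ClosureGraph.exists_right [CompactSpace X] [T2Space X] (hd : Dense {r : X | p r}) (x : X) :
    ∃ y, ClosureGraph σ x y := by
  have hcl : IsClosed (Prod.fst '' closure (range fun r : {r : X // p r} => (r.1, (σ r).1))) :=
    (isClosed_closure.isCompact.image continuous_fst).isClosed
  have hsub : {r : X | p r} ⊆
      Prod.fst '' closure (range fun r : {r : X // p r} => (r.1, (σ r).1)) := fun r hr =>
    ⟨_, subset_closure ⟨⟨r, hr⟩, rfl⟩, rfl⟩
  obtain ⟨⟨x', y⟩, hxy, rfl⟩ := hcl.closure_subset_iff.2 hsub (hd x)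
  exact ⟨y, closureGraph_iff.2 hxy⟩

variable [LocallyConnectedSpace X] [T1Space X]

/-- Otherwise a tree point `w` in the branch of `t` would have its image in the branch of `y`, and
preservation of branches would put `σ t` there as well. -/
theorem ClosureGraph.notMem_branchAt {x y : X} (h : ClosureGraph σ x y)
    (hσ : PreservesBranches σ) {s t : {r : X // p r}} (hy : y ≠ (σ s).1) (hts : t ≠ s)
    (ht : (σ t).1 ∉ branchAt (σ s).1 y) : x ∉ branchAt s.1 t.1 := by
  intro hx
  obtain ⟨w, hw, hw'⟩ := h _ _ (isOpen_branchAt s.1 t.1) (isOpen_branchAt (σ s).1 y) hx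
    (mem_branchAt_self hy)
  have hws : w ≠ s := by
    rintro rfl
    exact self_notMem_branchAt _ _ hw
  have h1 := (hσ s t w hts hws).1 (branchAt_eq_of_mem hw)
  rw [← branchAt_eq_of_mem hw'] at h1
  exact ht (h1 ▸ mem_branchAt_self fun he => hts (σ.injective (Subtype.ext he)))

end Extension

namespace IsDendrite

variable {X : Type*} [TopologicalSpace X] [CompactSpace X] [ConnectedSpace X]
  [LocallyConnectedSpace X] [TopologicalSpace.MetrizableSpace X]

/-- Two ramification points between `y` and `y'` pull back to `s` and `t`. Then `x` lies neither in
the branch at `s` towards `t` nor in the one at `t` towards `s`, yet these two cover the space. -/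
theorem closureGraph_unique (hX : IsDendrite X)
    (hR : IsArcwiseDense {r : X | IsRamificationPoint r})
    {σ : {r : X // IsRamificationPoint r} ≃ {r : X // IsRamificationPoint r}}
    (hσ : PreservesBranches σ) {x y y' : X} (h : ClosureGraph σ x y) (h' : ClosureGraph σ x y') :
    y = y' := by
  by_contra hne
  obtain ⟨s', hs', hsy, hsy', hsep, -, -⟩ := hX.exists_separating hR hne
  obtain ⟨t', ht', hts, hty', hsep', htb, -⟩ := hX.exists_separating hR hsy'
  obtain ⟨s, hs⟩ := σ.surjective ⟨s', hs'⟩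
  obtain ⟨t, ht⟩ := σ.surjective ⟨t', ht'⟩
  have hs1 : (σ s).1 = s' := by rw [hs]
  have ht1 : (σ t).1 = t' := by rw [ht]
  have hst : t ≠ s := by
    rintro rfl
    exact hts (ht1.symm.trans hs1)
  have h1 : x ∉ branchAt s.1 t.1 := by
    refine h.notMem_branchAt hσ (by rw [hs1]; exact hsy.symm) hst ?_
    rw [hs1, ht1]
    intro hmem
    apply hsep
    rw [eq_of_mem_branchAt hmem htb]
    exact mem_branchAt_self hsy'.symm
  have h2 : x ∉ branchAt t.1 s.1 := by
    refine h'.notMem_branchAt hσ (by rw [ht1]; exact hty'.symm) hst.symm ?_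
    rw [hs1, ht1]
    exact fun hmem => hsep' (mem_branchAt_comm.1 hmem)
  exact h2 ((isPreconnected_compl_branchAt s.1 t.1).subset_branchAt (self_notMem_branchAt _ _)
    (fun h => h (mem_branchAt_self fun he => hst (Subtype.ext he))) h1)

/-- The closure of the graph of `σ` in the compact square is the graph of a function, continuous
because its graph is closed. The same for `σ.symm` yields the inverse. -/
theorem exists_homeomorph_extend (hX : IsDendrite X) [Nontrivial X]
    (hR : IsArcwiseDense {r : X | IsRamificationPoint r})
    {σ : {r : X // IsRamificationPoint r} ≃ {r : X // IsRamificationPoint r}}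
    (hσ : PreservesBranches σ) : ∃ g : X ≃ₜ X, ∀ r : {r : X // IsRamificationPoint r},
      g r.1 = (σ r).1 := by
  have hd : Dense {r : X | IsRamificationPoint r} := by
    rw [dense_iff_inter_open]
    intro O hO hne
    rw [inter_comm]
    exact hX.exists_mem_of_isOpen hR hO hne
  have hcont : ∀ (τ : {r : X // IsRamificationPoint r} ≃ {r : X // IsRamificationPoint r})
      (f : X → X), PreservesBranches τ → (∀ x, ClosureGraph τ x (f x)) → Continuous f := by
    intro τ f hτ hf
    refine continuous_iff_isClosed.2 fun C hC => ?_
    have : f ⁻¹' C = Prod.fst '' (closure (range fun r : {r : X // IsRamificationPoint r} =>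
        (r.1, (τ r).1)) ∩ Prod.snd ⁻¹' C) := by
      ext x
      constructor
      · exact fun hx => ⟨(x, f x), ⟨closureGraph_iff.1 (hf x), hx⟩, rfl⟩
      · rintro ⟨⟨x, y⟩, ⟨hxy, hy⟩, rfl⟩
        change f x ∈ C
        rw [hX.closureGraph_unique hR hτ (hf x) (closureGraph_iff.2 hxy)]
        exact hy
    rw [this]
    exact ((isClosed_closure.inter (hC.preimage continuous_snd)).isCompact.image
      continuous_fst).isClosed
  choose f hf using ClosureGraph.exists_right (σ := σ) hd
  choose k hk using ClosureGraph.exists_right (σ := σ.symm) hd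
  refine ⟨{ toFun := f, invFun := k,
            left_inv := fun x => hX.closureGraph_unique hR hσ.symm (hk (f x)) (hf x).symm,
            right_inv := fun x => hX.closureGraph_unique hR hσ (hf (k x)) (hk x).symm,
            continuous_toFun := hcont σ f hσ hf,
            continuous_invFun := hcont σ.symm k hσ.symm hk }, fun r => ?_⟩
  exact hX.closureGraph_unique hR hσ (hf r.1) (closureGraph_apply r)

end IsDendrite

/-! ### Homeomorphisms of Ważewski dendrites -/

theorem Homeomorph.mem_branchAt {X : Type*} [TopologicalSpace X] (g : X ≃ₜ X) {r a b : X}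
    (h : b ∈ branchAt r a) : g b ∈ branchAt (g r) (g a) := by
  have ha : a ∈ branchAt r a := left_mem_branchAt h
  refine ((isPreconnected_branchAt r a).image g g.continuous.continuousOn).subset_branchAt
    ⟨a, ha, rfl⟩ ?_ ⟨b, h, rfl⟩
  rintro ⟨c, hc, hcr⟩
  exact ne_of_mem_branchAt hc (g.injective hcr)

namespace IsDendrite

variable {X : Type*} [TopologicalSpace X] [CompactSpace X] [ConnectedSpace X]
  [LocallyConnectedSpace X] [TopologicalSpace.MetrizableSpace X] [Nontrivial X]

theorem exists_homeomorph_pair (hX : IsDendrite X) {x : X} (hx : IsEndLike x)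
    (hR : IsArcwiseDense {r : X | IsRamificationPoint r})
    (hc : ∀ c : X, IsRamificationPoint c →
      IsArcwiseDense {r : X | IsRamificationPoint r ∧ pointOrder r = pointOrder c})
    {a b a' b' : X} (ha : IsRamificationPoint a) (hb : IsRamificationPoint b)
    (ha' : IsRamificationPoint a') (hb' : IsRamificationPoint b')
    (hab : RootLE x a b) (hne : a ≠ b) (hab' : RootLE x a' b') (hne' : a' ≠ b')
    (haa : pointOrder a = pointOrder a') (hbb : pointOrder b = pointOrder b') :
    ∃ g : X ≃ₜ X, g a = a' ∧ g b = b' ∧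
      ∀ r, IsRamificationPoint r → ∀ z, z ∈ branchAt r x ↔ g z ∈ branchAt (g r) x := by
  let _ := hX.ramificationTree hx
  have : Countable {r : X // IsRamificationPoint r} := hX.countable_isRamificationPoint.to_subtype
  obtain ⟨σ, hσa, hσb⟩ := (hX.isRichTree hx hR hc).exists_orderIso_pair (a := ⟨a, ha⟩)
    (b := ⟨b, hb⟩) (a' := ⟨a', ha'⟩) (b' := ⟨b', hb'⟩)
    (lt_of_le_of_ne hab fun h => hne (congrArg Subtype.val h))
    (lt_of_le_of_ne hab' fun h => hne' (congrArg Subtype.val h)) haa hbb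
  have hle : ∀ r s : {r : X // IsRamificationPoint r},
      RootLE x r.1 s.1 ↔ RootLE x (σ r).1 (σ s).1 := fun r s => (σ.le_iff_le (x := r) (y := s)).symm
  have hσ : PreservesBranches σ.toEquiv := by
    intro s r w hr hw
    have hr' : (σ r).1 ≠ (σ s).1 := fun h => hr (σ.injective (Subtype.ext h))
    have hw' : (σ w).1 ≠ (σ s).1 := fun h => hw (σ.injective (Subtype.ext h))
    rw [hX.branchAt_eq_iff hx r.2 w.2 (fun h => hr (Subtype.ext h)) (fun h => hw (Subtype.ext h))]
    refine Iff.trans ?_ (hX.branchAt_eq_iff hx (σ r).2 (σ w).2 hr' hw').symm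
    rw [← hle, ← hle]
    refine or_congr_left ?_
    constructor
    · rintro ⟨m, hm, h1, h2, h3, h4⟩
      exact ⟨(σ ⟨m, hm⟩).1, (σ ⟨m, hm⟩).2,
        fun h => h1 (congrArg Subtype.val (σ.injective (Subtype.ext h))),
        (hle s ⟨m, hm⟩).1 h2, (hle ⟨m, hm⟩ r).1 h3, (hle ⟨m, hm⟩ w).1 h4⟩
    · rintro ⟨m, hm, h1, h2, h3, h4⟩
      obtain ⟨n, hn⟩ := σ.surjective ⟨m, hm⟩
      obtain rfl : (σ n).1 = m := by rw [hn]
      refine ⟨n.1, n.2, fun h => h1 ?_, (hle s n).2 h2, (hle n r).2 h3, (hle n w).2 h4⟩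
      rw [Subtype.ext h]
  obtain ⟨g, hg⟩ := hX.exists_homeomorph_extend hR hσ
  refine ⟨g, (hg ⟨a, ha⟩).trans (congrArg Subtype.val hσa),
    (hg ⟨b, hb⟩).trans (congrArg Subtype.val hσb), fun r hr z => ?_⟩
  have hrx : x ≠ r := fun h => hx.not_isRamificationPoint (h ▸ hr)
  -- The root is not a ramification point, so a tree point `w` in its branch represents that branch.
  obtain ⟨w, hw, hwr⟩ := hX.exists_mem_of_isOpen hR (isOpen_branchAt r x)
    ⟨x, mem_branchAt_self hrx⟩
  have hgw : g w ∈ branchAt (g r) x := by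
    by_contra h
    have h1 : RootLE x (σ ⟨r, hr⟩).1 (σ ⟨w, hw⟩).1 := by
      intro h2
      apply h
      rw [hg ⟨r, hr⟩, hg ⟨w, hw⟩]
      exact h2
    exact (hle ⟨r, hr⟩ ⟨w, hw⟩).2 h1 hwr
  rw [branchAt_eq_of_mem hwr, branchAt_eq_of_mem hgw]
  refine ⟨g.mem_branchAt, fun h => ?_⟩
  simpa using g.symm.mem_branchAt h

theorem exists_homeomorph_contracting (hX : IsDendrite X) {x : X} (hx : IsEndLike x)
    (hR : IsArcwiseDense {r : X | IsRamificationPoint r})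
    (hc : ∀ c : X, IsRamificationPoint c →
      IsArcwiseDense {r : X | IsRamificationPoint r ∧ pointOrder r = pointOrder c})
    {q : X} (hq : IsRamificationPoint q) {y : X} (hy : IsEndLike y) (hyx : y ≠ x)
    {F : Set X} (hF : F.Finite) (hyF : y ∉ F) {V : Set X} (hV : IsOpen V) (hxV : x ∈ V) :
    ∃ g : X ≃ₜ X, (∀ z ∈ F, g z ∈ V) ∧ g y ∉ branchAt q x := by
  obtain ⟨r, hr, hry, c, hFc, hyc⟩ := hy (insert x F) (hF.insert x) (by
    rintro (h | h)
    · exact hyx h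
    · exact hyF h)
  have hcx := branchAt_eq_of_mem (hFc (mem_insert x F))
  rw [hcx] at hFc hyc
  obtain ⟨s, ⟨hs, hsq⟩, hsr, hsy, hrs, hsy'⟩ := hX.exists_rootLE_between (hc q hq) hyc hry
  have hqx : q ≠ x := fun h => hx.not_isRamificationPoint (h ▸ hq)
  -- Removing `q` from `V` puts `q` beyond `t`, so that any `r'` between `x` and `t` precedes `q`.
  obtain ⟨t, ht, htx, htV⟩ := hx.exists_branchAt_subset (hV.inter isOpen_compl_singleton)
    (show x ∈ V ∩ {q}ᶜ from ⟨hxV, hqx.symm⟩)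
  obtain ⟨r', ⟨hr', hrr'⟩, -, hrt, -, hr't⟩ := hX.exists_rootLE_between (hc r hr)
    (RootLE.root_le x t) htx.symm
  have htq : RootLE x t q := fun h => (htV h).2 rfl
  have hr'q : r' ≠ q := by
    rintro rfl
    exact hrt (hr't.antisymm htq)
  -- The branch at `r` towards `x`, containing `F`, shrinks to the one at `r'`, inside `V`; `y`,
  -- beyond `s`, is pushed beyond `q`.
  obtain ⟨g, hgr, hgs, hg⟩ := hX.exists_homeomorph_pair hx hR hc hr hs hr' hq hrs hsr.symm
    (hr't.trans htq) hr'q hrr'.symm hsq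
  refine ⟨g, fun z hz => ?_, fun h => ?_⟩
  · have h1 := (hg r hr z).1 (hFc (mem_insert_of_mem _ hz))
    rw [hgr] at h1
    exact (htV (hr't.branchAt_subset h1)).1
  · rw [← hgs] at h
    exact hsy' ((hg s hs y).2 h)

end IsDendrite

/-! ### Failure of first countability -/

/-- Suppose `x` has a neighbourhood `N` such that, away from any countable set, there is a point
`y` for which every finite set missing `y` can be moved into any given neighbourhood of `x` while
`y` is moved out of `N`. Then the Ellis semigroup is not first countable at the constant map `x`. -/
theorem not_firstCountableTopology_ellisSemigroup {G X : Type*} [Group G] [MulAction G X]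
    [TopologicalSpace X] {x : X} {N : Set X} (hN : IsOpen N) (hxN : x ∈ N)
    (h : ∀ S : Set X, S.Countable → ∃ y ∉ S, ∀ F : Set X, F.Finite → y ∉ F → ∀ V : Set X,
      IsOpen V → x ∈ V → ∃ g : G, (∀ z ∈ F, g • z ∈ V) ∧ g • y ∉ N) :
    ¬ FirstCountableTopology (ellisSemigroup G X) := by
  intro hfc
  have hbasic : ∀ s ∈ 𝓝 (fun _ : X => x), ∃ F : Set X, F.Finite ∧ ∃ V : Set X, IsOpen V ∧
      x ∈ V ∧ ∀ f : X → X, (∀ z ∈ F, f z ∈ V) → f ∈ s := by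
    intro s hs
    rw [nhds_pi, Filter.mem_pi] at hs
    obtain ⟨I, hI, t, ht, hts⟩ := hs
    refine ⟨I, hI, ⋂ i ∈ I, interior (t i), hI.isOpen_biInter fun i _ => isOpen_interior, ?_, ?_⟩
    · exact mem_iInter₂.2 fun i _ => mem_interior_iff_mem_nhds.2 (ht i)
    · exact fun f hf => hts fun i hi => interior_subset (mem_iInter₂.1 (hf i hi) i hi)
  have hmem : (fun _ : X => x) ∈ ellisSemigroup G X := by
    refine mem_closure_iff_nhds.2 fun s hs => ?_
    obtain ⟨F, hF, V, hV, hxV, hFV⟩ := hbasic s hs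
    obtain ⟨y, hy, hyg⟩ := h F hF.countable
    -- Taking the countable set to be `F` itself, some translation is close to the constant map.
    obtain ⟨g, hg, -⟩ := hyg F hF hy V hV hxV
    exact ⟨_, hFV _ hg, g, rfl⟩
  obtain ⟨s, hs⟩ := (𝓝 (⟨_, hmem⟩ : ellisSemigroup G X)).exists_antitone_basis
  have hs' : ∀ n, ∃ F : Set X, F.Finite ∧ ∃ V : Set X, IsOpen V ∧ x ∈ V ∧
      ∀ f : ellisSemigroup G X, (∀ z ∈ F, f.1 z ∈ V) → f ∈ s n := by
    intro n
    have hn := hs.mem n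
    rw [nhds_subtype, Filter.mem_comap] at hn
    obtain ⟨t, ht, hts⟩ := hn
    obtain ⟨F, hF, V, hV, hxV, hFV⟩ := hbasic t ht
    exact ⟨F, hF, V, hV, hxV, fun f hf => hts (hFV f.1 hf)⟩
  choose F hF V hV hxV hFV using hs'
  -- Diagonal choice: `y` is a coordinate that no member of the base controls.
  obtain ⟨y, hy, hyg⟩ := h (⋃ n, F n) (countable_iUnion fun n => (hF n).countable)
  have hO : {f : ellisSemigroup G X | f.1 y ∈ N} ∈ 𝓝 (⟨_, hmem⟩ : ellisSemigroup G X) :=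
    (hN.preimage ((continuous_apply y).comp continuous_subtype_val)).mem_nhds hxN
  obtain ⟨n, hn⟩ := hs.mem_iff.1 hO
  obtain ⟨g, hg, hgy⟩ := hyg (F n) (hF n) (fun h => hy (mem_iUnion.2 ⟨n, h⟩)) (V n) (hV n) (hxV n)
  exact hgy (hn (hFV n ⟨fun z => g • z, subset_closure ⟨g, rfl⟩⟩ hg))

theorem mainTheorem1 (P : Set ℕ∞) (hP : ∀ p ∈ P, 3 ≤ p) (hne : P.Nonempty)
    (W : Type*) [TopologicalSpace W] (hW : IsWazewskiDendrite P W) :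
    ¬ FirstCountableTopology (ellisSemigroup (W ≃ₜ W) W) ∧ ¬ IsTameOne (W ≃ₜ W) W := by
  have hX := hW.isDendrite
  have := hX.compactSpace
  have := hX.connectedSpace
  have := hX.locallyConnectedSpace
  have := hX.metrizableSpace
  have := hW.nontrivial
  have hc : ∀ c : W, IsRamificationPoint c →
      IsArcwiseDense {r : W | IsRamificationPoint r ∧ pointOrder r = pointOrder c} :=
    fun c hc => hW.arcwiseDense _ (hW.order_mem c hc)
  have hR : IsArcwiseDense {r : W | IsRamificationPoint r} := by
    obtain ⟨p, hp⟩ := hne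
    intro a b A hA
    obtain ⟨r, hr, hrA⟩ := hW.arcwiseDense p hp a b A hA
    exact ⟨r, hr.1, hrA⟩
  have key : ¬ FirstCountableTopology (ellisSemigroup (W ≃ₜ W) W) := by
    obtain ⟨x, -, hx⟩ := hX.exists_isEndLike hR countable_empty
    obtain ⟨q, hq, -⟩ := hX.exists_mem_of_isOpen hR isOpen_univ univ_nonempty
    have hqx : x ≠ q := fun h => hx.not_isRamificationPoint (h ▸ hq)
    refine not_firstCountableTopology_ellisSemigroup (isOpen_branchAt q x)
      (mem_branchAt_self hqx) fun S hS => ?_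
    -- Inserting `x` into the countable set ensures `y ≠ x`.
    obtain ⟨y, hyS, hy⟩ := hX.exists_isEndLike hR (hS.insert x)
    refine ⟨y, fun h => hyS (mem_insert_of_mem _ h), fun F hF hyF V hV hxV => ?_⟩
    exact hX.exists_homeomorph_contracting hx hR hc hq hy
      (fun h => hyS (h ▸ mem_insert _ _)) hF hyF hV hxV
  exact ⟨key, fun h => key h.2⟩
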